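/- **Setting.** There are $K\ge 1$ arms. The mean reward $\mu_i\in[0,1]$ of arm $i$ is drawn independently from a prior $\mathcal P_i$, and given the mean rewards, the samples (rewards) of arm $i$ are independent Bernoulli variables with mean $\mu_i$. In each round $t$ a (randomized) bandit algorithm recommends an arm $A_t$ as a function of the past arms and rewards and of its internal randomness; the arm is chosen, and a new sample of it is observed. The algorithm is *BIC* up to a horizon $T$ if $\mathbb E[\mu_i-\mu_j\mid A_t=i]\ge 0$ for all rounds $t\le T$ and all arms $i,j$ with $\Pr[A_t=i]>0$. Let $T_{\mathrm{OPT}}(N)$ be the smallest $T$ such that some bandit algorithm is BIC up to horizon $T$ and almost surely collects at least $N$ samples of each arm within $T$ rounds. Write $\mu_i^0=\mathbb E[\mu_i]$, and order the arms by decreasing $\mu_i^0$ (ties broken by index); below, "precedes" refers to this order. Write $x_+=\max(x,0)$ and $x_-=\max(-x,0)$. * Fix an absolute constant $C_{\mathrm{TS}}>0$ and let $N_{\mathrm{TS}}=\lceil C_{\mathrm{TS}}\,\varepsilon_{\mathrm{TS}}^{-2}\log(1/\delta_{\mathrm{TS}})\rceil$, where $\varepsilon_{\mathrm{TS}}=\min_{i\ne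 j}\mathbb E[(\mu_i-\mu_j)_+]$, $\delta_{\mathrm{TS}}=\min_i\Pr[A^*=i]$, and $A^*$ is the arm with the largest mean reward (the first such arm in the order above, in case of ties); for $K=1$ let $N_{\mathrm{TS}}=0$. This is the number of samples of each arm used to warm-start Thompson Sampling. * Let $T_{\mathrm{LB}}=\max(K,N_{\mathrm{boot}},L)$, where $N_{\mathrm{boot}}$ is the smallest $N\in\{0,1,2,\dots\}$ such that, for every arm $j$ and every arm $i$ preceding $j$, $\mathbb E[\mu_j-\mu_i\mid \text{the first } N \text{ samples of each arm preceding } j \text{ are all } 0]>0$, and $$L=\max_{j,\,q}\ \frac{\mathbb E[(\mu_j-\mu_q)_-]}{\mathbb E[(\mu_j-\mu_q)_+]},\qquad \mu_q=\sum_i q_i\mu_i,$$ the maximum being over all arms $j$ and all probability distributions $q$ over arms (with $0/0$ read as $0$). **Corollary 5.5.** For $\nu\in[0,1]$ and $0<\sigma\le 1$, let $\widetilde N(\nu,\sigma^2)$ be the Gaussian distribution with mean $\nu$ and variance $\sigma^2$, conditioned to lie in $[0,1]$. Suppose that $\mathcal P_i=\widetilde N(\nu_i,\sigma^2)$ for each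 arm $i$, where $\nu_1,\dots,\nu_K\in[0,1]$. (a) $T_{\mathrm{OPT}}(N_{\mathrm{TS}})\le K^3\cdot \mathrm{poly}(\sigma^{-1},e^{R^2})$, where $R=\sigma^{-1}\max_{i,j}|\nu_i-\nu_j|$. That is, for every $C_{\mathrm{TS}}>0$ there are $C>0$ and $a\in\mathbb N$, depending only on $C_{\mathrm{TS}}$, such that for all $K$, $\sigma$ and $\nu_1,\dots,\nu_K$ as above, $T_{\mathrm{OPT}}(N_{\mathrm{TS}})$ is finite and at most $K^3\cdot C\,(\sigma^{-1}e^{R^2})^a$. (b) $T_{\mathrm{LB}}\ge e^{\Omega(1/\sigma^2)}$ when $\max_{i,j}|\nu_i-\nu_j|$ is at least a positive absolute constant. That is, for every $c_0>0$ there is $c>0$, depending only on $c_0$, such that for all $K$, $\sigma$ and $\nu_1,\dots,\nu_K$ as above with $\max_{i,j}|\nu_i-\nu_j|\ge c_0$, one has $T_{\mathrm{LB}}\ge e^{c/\sigma^2}$. -/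

import Mathlib

open MeasureTheory ProbabilityTheory
open scoped ENNReal

noncomputable section

namespace IncentivizedExploration

/-! ### Priors -/

/-- The truncated Gaussian `Ñ(ν, σ²)`: a Gaussian with mean `ν` and variance `σ²`, conditioned
to lie in `[0, 1]`. -/
def truncatedGaussian (ν σ : ℝ) : Measure ℝ :=
  (gaussianReal ν (Real.toNNReal (σ ^ 2)))[|Set.Icc (0 : ℝ) 1]

/-- The mean of a prior, `μ_i⁰ = E[μ_i]`. -/
def priorMean (p : Measure ℝ) : ℝ := ∫ x, x ∂p

/-- The order in which arms are listed: by decreasing prior mean reward, ties being broken by the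
index. If the arms are indexed so that `μ_1⁰ ≥ ... ≥ μ_K⁰`, this is just `i < j`. -/
def Precedes {K : ℕ} (P : Fin K → Measure ℝ) (i j : Fin K) : Prop :=
  priorMean (P j) < priorMean (P i) ∨ (priorMean (P i) = priorMean (P j) ∧ i < j)

/-! ### The environment: mean rewards and Bernoulli samples of the arms -/

/-- An outcome of the environment: the mean rewards `μ_i`, and, for each arm `i` and each `n`,
a number in `[0, 1]` which decides the `n`-th sample of arm `i`. -/
abbrev Env (K : ℕ) : Type := (Fin K → ℝ) × (Fin K × ℕ → unitInterval)

/-- The mean rewards are drawn independently from the priors `P i`; the deciding numbers are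
independent of them and of each other, and uniform on `[0, 1]`. -/
def envLaw {K : ℕ} (P : Fin K → Measure ℝ) : Measure (Env K) :=
  (Measure.pi P).prod (Measure.infinitePi fun _ : Fin K × ℕ => (volume : Measure unitInterval))

/-- The `n`-th sample (`n = 0, 1, ...`) of arm `i`; `true` is reward `1` and `false` is reward `0`.
Given the mean rewards, these are independent Bernoulli variables, with mean `μ_i` for arm `i`. -/
def sample {K : ℕ} (e : Env K) (i : Fin K) (n : ℕ) : Bool :=
  decide ((e.2 (i, n) : ℝ) < e.1 i)

/-! ### Bandit algorithms, the BIC property, and the optimal sample complexity -/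

/-- A (randomized) bandit algorithm: it recommends an arm as a function of its internal randomness
and of the list of all past (arm, reward) pairs, the most recent one first. -/
structure BanditAlgorithm (K : ℕ) where
  Seed : Type
  measurableSpace : MeasurableSpace Seed
  seedLaw : Measure Seed
  isProbabilityMeasure : IsProbabilityMeasure seedLaw
  recommend : Seed → List (Fin K × Bool) → Fin K
  measurable_recommend : ∀ h, Measurable fun ω => recommend ω h

attribute [instance] BanditAlgorithm.measurableSpace BanditAlgorithm.isProbabilityMeasure

namespace BanditAlgorithm

variable {K : ℕ} (alg : BanditAlgorithm K)

/-- The joint law of the internal randomness of the algorithm and of the environment, which are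
independent. -/
def law (P : Fin K → Measure ℝ) : Measure (alg.Seed × Env K) :=
  alg.seedLaw.prod (envLaw P)

/-- The history after `t` rounds, when all recommendations are followed: the `n`-th time that an arm
is chosen, its `n`-th sample is observed. -/
def history (x : alg.Seed × Env K) : ℕ → List (Fin K × Bool)
  | 0 => []
  | t + 1 =>
    let h := history x t
    let a := alg.recommend x.1 h
    (a, sample x.2 a (h.countP fun p => p.1 = a)) :: h

/-- The arm `A_t` recommended (and chosen) in round `t = 0, 1, ...`. -/
def arm (t : ℕ) (x : alg.Seed × Env K) : Fin K :=
  alg.recommend x.1 (alg.history x t)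

/-- The number of samples of arm `i` collected in the first `T` rounds. -/
def numSamples (T : ℕ) (i : Fin K) (x : alg.Seed × Env K) : ℕ :=
  (alg.history x T).countP fun p => p.1 = i

/-- The algorithm, run for `T` rounds, is Bayesian incentive-compatible:
`E[μ_i - μ_j | A_t = i] ≥ 0` in every round `t`, for all arms `i`, `j` with `Pr[A_t = i] > 0`.
(All past recommendations have been followed, by the definition of the history.) -/
def IsBIC (P : Fin K → Measure ℝ) (T : ℕ) : Prop :=
  ∀ t < T, ∀ i j : Fin K, 0 < alg.law P {x | alg.arm t x = i} →
    0 ≤ ∫ x, (x.2.1 i - x.2.1 j) ∂((alg.law P)[|{x | alg.arm t x = i}])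

/-- Within `T` rounds the algorithm almost surely collects at least `N` samples of each arm. -/
def Collects (P : Fin K → Measure ℝ) (T N : ℕ) : Prop :=
  ∀ᵐ x ∂(alg.law P), ∀ i, N ≤ alg.numSamples T i x

end BanditAlgorithm

/-- The sample complexity of incentivized exploration: the smallest time horizon `T` such that some
BIC bandit algorithm collects `N` samples of each arm almost surely (`⊤` if there is none). -/
def optimalRounds {K : ℕ} (P : Fin K → Measure ℝ) (N : ℕ) : ℕ∞ :=
  ⨅ (T : ℕ) (_ : ∃ alg : BanditAlgorithm K, alg.IsBIC P T ∧ alg.Collects P T N), (T : ℕ∞)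

/-! ### The number of samples that warm-starts Thompson Sampling -/

/-- `min E[(μ_i - μ_j)₊]` over all ordered pairs of distinct arms. -/
def epsTS {K : ℕ} (P : Fin K → Measure ℝ) : ℝ :=
  ⨅ p : {p : Fin K × Fin K // p.1 ≠ p.2}, ∫ m, max (m p.1.1 - m p.1.2) 0 ∂(Measure.pi P)

/-- The event that `i` is the best arm `A*`: it has the largest mean reward, and it is the first
such arm in the order of the arms. -/
def isBest {K : ℕ} (P : Fin K → Measure ℝ) (i : Fin K) : Set (Fin K → ℝ) :=
  {m | ∀ j, j ≠ i → m j < m i ∨ (m j = m i ∧ Precedes P i j)}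

/-- `min_i Pr[A* = i]`. -/
def deltaTS {K : ℕ} (P : Fin K → Measure ℝ) : ℝ :=
  ⨅ i : Fin K, (Measure.pi P).real (isBest P i)

/-- `N_TS = C · ε_TS⁻² · log (1 / δ_TS)`, rounded up, where `C` is an absolute constant. For `K = 1`,
where `ε_TS` is a minimum over no pairs, it is `0`, as `δ_TS = 1`. -/
def samplesTS {K : ℕ} (C : ℝ) (P : Fin K → Measure ℝ) : ℕ :=
  ⌈C * (epsTS P)⁻¹ ^ 2 * Real.log (deltaTS P)⁻¹⌉₊

/-! ### The lower bound on the sample complexity -/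

/-- The event that the first `N` samples of each arm that precedes `j` return reward `0`. -/
def zeros {K : ℕ} (P : Fin K → Measure ℝ) (j : Fin K) (N : ℕ) : Set (Env K) :=
  {e | ∀ i, Precedes P i j → ∀ n < N, sample e i n = false}

/-- `N_boot`: the smallest `N` such that `E[μ_j - μ_i | ZEROS_{j,N}] > 0` for every arm `j` and every
arm `i` that precedes `j` (`⊤` if there is none). -/
def bootSamples {K : ℕ} (P : Fin K → Measure ℝ) : ℕ∞ :=
  ⨅ (N : ℕ) (_ : ∀ i j : Fin K, Precedes P i j →
    0 < ∫ e, (e.1 j - e.1 i) ∂((envLaw P)[|zeros P j N])), (N : ℕ∞)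

/-- The mean reward `μ_q = ∑ i, q_i μ_i` of a distribution `q` over arms. -/
def mixedMean {K : ℕ} (q m : Fin K → ℝ) : ℝ := ∑ i, q i * m i

/-- The maximum over arms `j` and distributions `q` over arms of
`E[(μ_j - μ_q)₋] / E[(μ_j - μ_q)₊]`. In `[0, ∞]`, `a / 0 = ∞` for `a > 0`, and `0 / 0 = 0`; the
latter occurs for `q` concentrated on `j`, and then does not affect the maximum. -/
def mainLowerBound {K : ℕ} (P : Fin K → Measure ℝ) : ℝ≥0∞ :=
  ⨆ (j : Fin K) (q ∈ stdSimplex ℝ (Fin K)),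
    (∫⁻ m, ENNReal.ofReal (mixedMean q m - m j) ∂(Measure.pi P)) /
      (∫⁻ m, ENNReal.ofReal (m j - mixedMean q m) ∂(Measure.pi P))

/-- The lower bound `max (K, N_boot, L)` on the sample complexity, where `L` is the maximum just
defined. -/
def lowerBoundRounds {K : ℕ} (P : Fin K → Measure ℝ) : ℝ≥0∞ :=
  max (K : ℝ≥0∞) (max (bootSamples P : ℝ≥0∞) (mainLowerBound P))

/-- `max_{i,j} |ν_i - ν_j|`. -/
def spread {K : ℕ} (ν : Fin K → ℝ) : ℝ := ⨆ p : Fin K × Fin K, |ν p.1 - ν p.2|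

end IncentivizedExploration

end

/-! Part (a) rests on one quantity, the gap of `HasGap`: every mean reward exceeds every prior mean,
and falls below it, by at least `ε` on average. For truncated Gaussians `hasGap_truncatedGaussian`
gives `ε = e^{-R²} σ⁴ / 65536`: a truncated Gaussian deviates from its own mean by order `σ`, and
moving the center costs only a square and a factor `e^{R²}`, by a pointwise comparison of densities
and Jensen's inequality (`sq_integral_truncatedGaussian_le`).

With `ε ≥ 1/a`, an explicit algorithm (`explorer`) treats the arms by decreasing prior mean.
Exploring an arm is harmless when all its predecessors look worse than its own prior mean, but this
event may have probability as small as `(2a)^{-K}`. So the arm is also explored when the seed is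
below a level that rises from phase to phase. In each phase an arm that has already been explored is
recommended again if it looks at least as good as the largest prior mean. The resulting gain, at
least `1/(2a)` on average by `HasGap.le_integral_armHigh` and
`HasGap.le_integral_allLow_inter_armHigh`, pays for raising the level by a factor of about `1 +
1/(4a)` (`HasGap.integral_exploreSet_nonneg`). Exponential growth brings the level from order
`(2a)^{-K}` to `1` in `O(a² K)` phases (`level_phases`). When the arm is not recommended in this
way, a fixed arm which is best on average on that event is chosen. Looking low or high is decided by
`a²` samples, whose average error `1/(2a)` uses up half of the gap.

There are `K` arms, `O(a² K)` phases for each, and `max N a²` rounds per phase, and `samplesTS_le`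
gives `N_TS = O(a³ K)` because `δ_TS ≥ ε^K`. This yields `O(K³ a⁷)` rounds.

Part (b) needs only `L` and `K`. For small `σ`, compare two arms whose centers are far apart: the
lower one wins only on a Gaussian tail event, so the ratio in `L` is `e^{Ω(1/σ²)}`. For `σ` bounded
below, `K ≥ 2` suffices. -/

noncomputable section

namespace IncentivizedExploration

/-! ### Estimates for truncated Gaussians -/

/-- The unnormalized Gaussian density. -/
def gaussKernel (ν σ x : ℝ) : ℝ := Real.exp (-(x - ν) ^ 2 / (2 * σ ^ 2))

/-- The mass of the unnormalized Gaussian density on the unit interval. -/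
def gaussMass (ν σ : ℝ) : ℝ := ∫ x in Set.Icc (0 : ℝ) 1, gaussKernel ν σ x

lemma gaussKernel_pos (ν σ x : ℝ) : 0 < gaussKernel ν σ x := Real.exp_pos _

lemma gaussKernel_le_one (ν σ x : ℝ) : gaussKernel ν σ x ≤ 1 := by
  rw [gaussKernel, Real.exp_le_one_iff]
  exact div_nonpos_of_nonpos_of_nonneg (by nlinarith [sq_nonneg (x - ν)]) (by positivity)

@[fun_prop]
lemma continuous_gaussKernel (ν σ : ℝ) : Continuous (gaussKernel ν σ) := by
  unfold gaussKernel; fun_prop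

lemma integrableOn_gaussKernel (ν σ : ℝ) {a b : ℝ} :
    IntegrableOn (gaussKernel ν σ) (Set.Icc a b) :=
  (continuous_gaussKernel ν σ).continuousOn.integrableOn_compact isCompact_Icc

lemma gaussMass_le_one (ν σ : ℝ) : gaussMass ν σ ≤ 1 := by
  have := setIntegral_mono_on (integrableOn_gaussKernel ν σ) (integrableOn_const (by simp))
    measurableSet_Icc fun x (_ : x ∈ Set.Icc (0 : ℝ) 1) => gaussKernel_le_one ν σ x
  simpa [gaussMass] using this

/-- Since `σ ≤ 1`, an interval of length `σ / 2` with `ν` as an endpoint fits into `[0, 1]`, and the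
kernel is at least `1 / 2` on it. -/
lemma le_gaussMass {ν σ : ℝ} (hν : ν ∈ Set.Icc (0 : ℝ) 1) (hσ : 0 < σ) (hσ1 : σ ≤ 1) :
    σ / 4 ≤ gaussMass ν σ := by
  obtain ⟨a, ha0, ha1, haν, haν'⟩ : ∃ a : ℝ, 0 ≤ a ∧ a + σ / 2 ≤ 1 ∧ ν - σ / 2 ≤ a ∧ a ≤ ν := by
    rcases le_total ν (1 / 2) with h | h
    · exact ⟨ν, hν.1, by linarith, by linarith, le_rfl⟩
    · exact ⟨ν - σ / 2, by linarith, by linarith [hν.2], le_rfl, by linarith⟩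
  have key : ∀ x ∈ Set.Icc a (a + σ / 2), (1 / 2 : ℝ) ≤ gaussKernel ν σ x := by
    intro x hx
    have h1 : (x - ν) ^ 2 ≤ (σ / 2) ^ 2 := sq_le_sq' (by linarith [hx.1]) (by linarith [hx.2])
    have h2 : -(1 / 2 : ℝ) ≤ -(x - ν) ^ 2 / (2 * σ ^ 2) := by
      rw [le_div_iff₀ (by positivity)]; nlinarith
    calc (1 / 2 : ℝ) ≤ -(x - ν) ^ 2 / (2 * σ ^ 2) + 1 := by linarith
      _ ≤ _ := Real.add_one_le_exp _
  have h3 : ∫ x in Set.Icc a (a + σ / 2), (1 / 2 : ℝ) ≤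
      ∫ x in Set.Icc a (a + σ / 2), gaussKernel ν σ x :=
    setIntegral_mono_on (integrableOn_const (by simp)) (integrableOn_gaussKernel ν σ)
      measurableSet_Icc key
  have h4 : ∫ x in Set.Icc a (a + σ / 2), gaussKernel ν σ x ≤ gaussMass ν σ :=
    setIntegral_mono_set (integrableOn_gaussKernel ν σ)
      (Filter.Eventually.of_forall fun x => (gaussKernel_pos ν σ x).le)
      (Filter.Eventually.of_forall (Set.Icc_subset_Icc ha0 ha1))
  have h5 : ∫ x in Set.Icc a (a + σ / 2), (1 / 2 : ℝ) = σ / 4 := by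
    rw [setIntegral_const]
    rw [Real.volume_real_Icc_of_le (by linarith)]
    simp; ring
  linarith

lemma gaussMass_pos {ν σ : ℝ} (hν : ν ∈ Set.Icc (0 : ℝ) 1) (hσ : 0 < σ) (hσ1 : σ ≤ 1) :
    0 < gaussMass ν σ := lt_of_lt_of_le (by positivity) (le_gaussMass hν hσ hσ1)

lemma toReal_gaussianPDF_eq_gaussKernel {ν σ x : ℝ} :
    (gaussianPDF ν (Real.toNNReal (σ ^ 2)) x).toReal =
      (√(2 * Real.pi * σ ^ 2))⁻¹ * gaussKernel ν σ x := by
  rw [toReal_gaussianPDF, gaussianPDFReal, Real.coe_toNNReal _ (sq_nonneg σ), gaussKernel]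

lemma integral_gaussianReal_Icc {ν σ : ℝ} (hσ : 0 < σ) (f : ℝ → ℝ) :
    ∫ x in Set.Icc (0 : ℝ) 1, f x ∂(gaussianReal ν (Real.toNNReal (σ ^ 2))) =
      (√(2 * Real.pi * σ ^ 2))⁻¹ * ∫ x in Set.Icc (0 : ℝ) 1, gaussKernel ν σ x * f x := by
  have hv : Real.toNNReal (σ ^ 2) ≠ 0 := by
    rw [Ne, Real.toNNReal_eq_zero, not_le]; positivity
  rw [gaussianReal_of_var_ne_zero _ hv, setIntegral_withDensity_eq_setIntegral_toReal_smul
    (measurable_gaussianPDF _ _) (by simp [gaussianPDF_lt_top]) _ measurableSet_Icc,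
    ← integral_const_mul]
  simp_rw [toReal_gaussianPDF_eq_gaussKernel, smul_eq_mul, mul_assoc]

lemma gaussianReal_real_Icc {ν σ : ℝ} (hσ : 0 < σ) :
    (gaussianReal ν (Real.toNNReal (σ ^ 2))).real (Set.Icc (0 : ℝ) 1) =
      (√(2 * Real.pi * σ ^ 2))⁻¹ * gaussMass ν σ := by
  have := integral_gaussianReal_Icc (ν := ν) hσ fun _ => 1
  simpa [gaussMass] using this

lemma integral_truncatedGaussian {ν σ : ℝ} (hσ : 0 < σ) (f : ℝ → ℝ) :
    ∫ x, f x ∂(truncatedGaussian ν σ) =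
      (gaussMass ν σ)⁻¹ * ∫ x in Set.Icc (0 : ℝ) 1, gaussKernel ν σ x * f x := by
  have hc : (√(2 * Real.pi * σ ^ 2)) ≠ 0 := by positivity
  rw [truncatedGaussian, ProbabilityTheory.cond, integral_smul_measure, ENNReal.toReal_inv]
  change ((gaussianReal ν (Real.toNNReal (σ ^ 2))).real (Set.Icc (0 : ℝ) 1))⁻¹ • _ = _
  rw [gaussianReal_real_Icc hσ, integral_gaussianReal_Icc hσ, smul_eq_mul]
  field_simp

lemma isProbabilityMeasure_truncatedGaussian {ν σ : ℝ} (hν : ν ∈ Set.Icc (0 : ℝ) 1) (hσ : 0 < σ)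
    (hσ1 : σ ≤ 1) : IsProbabilityMeasure (truncatedGaussian ν σ) := by
  refine cond_isProbabilityMeasure fun h => ?_
  have h1 := gaussianReal_real_Icc (ν := ν) hσ
  rw [Measure.real, h] at h1
  have : 0 < (√(2 * Real.pi * σ ^ 2))⁻¹ * gaussMass ν σ :=
    mul_pos (by positivity) (gaussMass_pos hν hσ hσ1)
  simp at h1 this
  rcases h1 with h1 | h1
  · exact absurd h1 (by positivity)
  · exact absurd h1 (gaussMass_pos hν hσ hσ1).ne'

lemma ae_truncatedGaussian_mem_Icc (ν σ : ℝ) :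
    ∀ᵐ x ∂(truncatedGaussian ν σ), x ∈ Set.Icc (0 : ℝ) 1 :=
  ae_cond_mem measurableSet_Icc

lemma truncatedGaussian_real {ν σ : ℝ} (hσ : 0 < σ) {s : Set ℝ} (hs : MeasurableSet s) :
    (truncatedGaussian ν σ).real s =
      (gaussMass ν σ)⁻¹ * ∫ x in Set.Icc (0 : ℝ) 1 ∩ s, gaussKernel ν σ x := by
  rw [← integral_indicator_one hs, integral_truncatedGaussian hσ, ← setIntegral_indicator hs]
  congr 2 with x
  by_cases hx : x ∈ s <;> simp [hx]

/-- An interval of length `d` has mass at most `4 d / σ`. -/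
lemma truncatedGaussian_real_Icc_le {ν σ : ℝ} (hν : ν ∈ Set.Icc (0 : ℝ) 1) (hσ : 0 < σ)
    (hσ1 : σ ≤ 1) {a b : ℝ} (hab : a ≤ b) :
    (truncatedGaussian ν σ).real (Set.Icc a b) ≤ 4 * (b - a) / σ := by
  rw [truncatedGaussian_real hσ measurableSet_Icc]
  have h1 : ∫ x in Set.Icc (0 : ℝ) 1 ∩ Set.Icc a b, gaussKernel ν σ x ≤ b - a := by
    calc _ ≤ ∫ x in Set.Icc a b, gaussKernel ν σ x :=
          setIntegral_mono_set (integrableOn_gaussKernel ν σ)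
            (Filter.Eventually.of_forall fun x => (gaussKernel_pos ν σ x).le)
            (Filter.Eventually.of_forall Set.inter_subset_right)
      _ ≤ ∫ x in Set.Icc a b, (1 : ℝ) :=
          setIntegral_mono_on (integrableOn_gaussKernel ν σ) (integrableOn_const (by simp))
            measurableSet_Icc fun x _ => gaussKernel_le_one ν σ x
      _ = b - a := by simp [Real.volume_real_Icc_of_le hab]
  have h2 := le_gaussMass hν hσ hσ1
  have h3 := gaussMass_pos hν hσ hσ1
  rw [inv_mul_eq_div, div_le_div_iff₀ h3 hσ]
  nlinarith [sub_nonneg.2 hab]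

/-- The mass at distance at least `t` from the center. -/
lemma truncatedGaussian_real_tail_le {ν σ : ℝ} (hν : ν ∈ Set.Icc (0 : ℝ) 1) (hσ : 0 < σ)
    (hσ1 : σ ≤ 1) {t : ℝ} (ht : 0 ≤ t) :
    (truncatedGaussian ν σ).real {x | t ≤ |x - ν|} ≤ 4 / σ * Real.exp (-t ^ 2 / (2 * σ ^ 2)) := by
  have hm : MeasurableSet {x : ℝ | t ≤ |x - ν|} := measurableSet_le (by fun_prop) (by fun_prop)
  rw [truncatedGaussian_real hσ hm]
  have h1 : ∫ x in Set.Icc (0 : ℝ) 1 ∩ {x | t ≤ |x - ν|}, gaussKernel ν σ x ≤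
      Real.exp (-t ^ 2 / (2 * σ ^ 2)) := by
    calc _ ≤ ∫ x in Set.Icc (0 : ℝ) 1 ∩ {x | t ≤ |x - ν|}, Real.exp (-t ^ 2 / (2 * σ ^ 2)) := by
          refine setIntegral_mono_on ((integrableOn_gaussKernel ν σ).mono_set Set.inter_subset_left)
            (integrableOn_const ?_) (measurableSet_Icc.inter hm) fun x hx => ?_
          · exact (measure_mono_top Set.inter_subset_left).mt (by simp)
          · unfold gaussKernel
            have : t ^ 2 ≤ (x - ν) ^ 2 := by
              rw [← sq_abs (x - ν)]; exact pow_le_pow_left₀ ht hx.2 2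
            gcongr
      _ ≤ ∫ x in Set.Icc (0 : ℝ) 1, Real.exp (-t ^ 2 / (2 * σ ^ 2)) :=
          setIntegral_mono_set (integrableOn_const (by simp))
            (Filter.Eventually.of_forall fun x => (Real.exp_pos _).le)
            (Filter.Eventually.of_forall Set.inter_subset_left)
      _ = _ := by simp
  have h2 := le_gaussMass hν hσ hσ1
  have h3 := gaussMass_pos hν hσ hσ1
  have h4 := Real.exp_pos (-t ^ 2 / (2 * σ ^ 2))
  rw [inv_mul_eq_div, div_mul_eq_mul_div, div_le_div_iff₀ h3 hσ]
  nlinarith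

/-- Completing the square: the difference of the two exponents is `(x - 2ν' + ν)² / (2σ²)`. Squaring
the kernel on the left is what makes the comparison uniform in `x`. -/
lemma gaussKernel_sq_le {ν ν' σ : ℝ} (hσ : 0 < σ) (x : ℝ) :
    Real.exp (-(σ⁻¹ * |ν' - ν|) ^ 2) * gaussKernel ν' σ x ^ 2 ≤ gaussKernel ν σ x := by
  rw [gaussKernel, gaussKernel, ← Real.exp_nat_mul, ← Real.exp_add, Real.exp_le_exp, mul_pow,
    sq_abs, inv_pow, ← sub_nonneg]
  have : -(x - ν) ^ 2 / (2 * σ ^ 2) - (-((σ ^ 2)⁻¹ * (ν' - ν) ^ 2) +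
      (2 : ℕ) * (-(x - ν') ^ 2 / (2 * σ ^ 2))) = (x - 2 * ν' + ν) ^ 2 / (2 * σ ^ 2) := by
    field_simp; push_cast; ring
  rw [this]; positivity

/-- Comparison of expectations under truncated Gaussians with different centers. -/
lemma sq_integral_truncatedGaussian_le {ν ν' σ : ℝ} (hν : ν ∈ Set.Icc (0 : ℝ) 1)
    (hν' : ν' ∈ Set.Icc (0 : ℝ) 1) (hσ : 0 < σ) (hσ1 : σ ≤ 1) {f : ℝ → ℝ} (hf : Continuous f)
    (hf0 : ∀ x ∈ Set.Icc (0 : ℝ) 1, 0 ≤ f x) (hf1 : ∀ x ∈ Set.Icc (0 : ℝ) 1, f x ≤ 1) :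
    Real.exp (-(σ⁻¹ * |ν' - ν|) ^ 2) * (σ / 4 * ∫ x, f x ∂(truncatedGaussian ν' σ)) ^ 2 ≤
      ∫ x, f x ∂(truncatedGaussian ν σ) := by
  have : IsProbabilityMeasure ((volume : Measure ℝ).restrict (Set.Icc 0 1)) := ⟨by simp⟩
  have hint : ∀ g : ℝ → ℝ, Continuous g → IntegrableOn g (Set.Icc 0 1) := fun g hg =>
    hg.continuousOn.integrableOn_compact isCompact_Icc
  have hfi0 : ∀ c, 0 ≤ ∫ x in Set.Icc (0 : ℝ) 1, gaussKernel c σ x * f x := fun c =>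
    setIntegral_nonneg measurableSet_Icc fun x hx => mul_nonneg (gaussKernel_pos _ _ _).le (hf0 x hx)
  have h1 : σ / 4 * ∫ x, f x ∂(truncatedGaussian ν' σ) ≤
      ∫ x in Set.Icc (0 : ℝ) 1, gaussKernel ν' σ x * f x := by
    rw [integral_truncatedGaussian hσ, ← mul_assoc]
    refine mul_le_of_le_one_left (hfi0 ν') ?_
    rw [← div_eq_mul_inv, div_le_one (gaussMass_pos hν' hσ hσ1)]
    exact le_gaussMass hν' hσ hσ1
  have h0 : 0 ≤ σ / 4 * ∫ x, f x ∂(truncatedGaussian ν' σ) := by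
    rw [integral_truncatedGaussian hσ]
    have := gaussMass_pos hν' hσ hσ1
    have := hfi0 ν'
    positivity
  -- Jensen's inequality for the square; Lebesgue measure on `[0, 1]` is a probability measure.
  have h2 : (∫ x in Set.Icc (0 : ℝ) 1, gaussKernel ν' σ x * f x) ^ 2 ≤
      ∫ x in Set.Icc (0 : ℝ) 1, (gaussKernel ν' σ x * f x) ^ 2 := by
    refine ConvexOn.map_integral_le (even_two.convexOn_pow (𝕜 := ℝ)) (by fun_prop) isClosed_univ
      (by simp) (hint _ (by fun_prop)) (hint _ (by fun_prop))
  calc Real.exp (-(σ⁻¹ * |ν' - ν|) ^ 2) * (σ / 4 * ∫ x, f x ∂(truncatedGaussian ν' σ)) ^ 2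
      ≤ Real.exp (-(σ⁻¹ * |ν' - ν|) ^ 2) *
        ∫ x in Set.Icc (0 : ℝ) 1, (gaussKernel ν' σ x * f x) ^ 2 := by
        gcongr
        exact (pow_le_pow_left₀ h0 h1 2).trans h2
    _ ≤ ∫ x in Set.Icc (0 : ℝ) 1, gaussKernel ν σ x * f x := by
        rw [← integral_const_mul]
        refine setIntegral_mono_on (hint _ (by fun_prop)) (hint _ (by fun_prop)) measurableSet_Icc
          fun x hx => ?_
        calc _ = (Real.exp (-(σ⁻¹ * |ν' - ν|) ^ 2) * gaussKernel ν' σ x ^ 2) * (f x * f x) := by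
              ring
          _ ≤ gaussKernel ν σ x * (f x * 1) :=
              mul_le_mul (gaussKernel_sq_le hσ x)
                (mul_le_mul_of_nonneg_left (hf1 x hx) (hf0 x hx))
                (mul_nonneg (hf0 x hx) (hf0 x hx)) (gaussKernel_pos _ _ _).le
          _ = _ := by ring
    _ ≤ _ := by
        rw [integral_truncatedGaussian hσ]
        refine le_mul_of_one_le_left (hfi0 ν) ?_
        exact (one_le_inv₀ (gaussMass_pos hν hσ hσ1)).2 (gaussMass_le_one ν σ)

lemma integrable_of_ae_mem_Icc {p : Measure ℝ} [IsProbabilityMeasure p]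
    (hp : ∀ᵐ x ∂p, x ∈ Set.Icc (0 : ℝ) 1) : Integrable (fun x : ℝ => x) p :=
  Integrable.of_bound (by fun_prop) 1 (hp.mono fun x hx => by
    rw [Real.norm_eq_abs, abs_of_nonneg hx.1]; exact hx.2)

lemma priorMean_mem_Icc {p : Measure ℝ} [IsProbabilityMeasure p]
    (hp : ∀ᵐ x ∂p, x ∈ Set.Icc (0 : ℝ) 1) : priorMean p ∈ Set.Icc (0 : ℝ) 1 := by
  constructor
  · exact integral_nonneg_of_ae (hp.mono fun x hx => hx.1)
  · calc priorMean p ≤ ∫ _, (1 : ℝ) ∂p :=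
        integral_mono_ae (integrable_of_ae_mem_Icc hp) (integrable_const _) (hp.mono fun x hx => hx.2)
      _ = 1 := by simp

/-- The deviation from the mean integrates to zero, so its positive and negative parts balance. -/
lemma integral_posPart_eq_integral_negPart {p : Measure ℝ} [IsProbabilityMeasure p]
    (hp : ∀ᵐ x ∂p, x ∈ Set.Icc (0 : ℝ) 1) :
    ∫ x, max (x - priorMean p) 0 ∂p = ∫ x, max (priorMean p - x) 0 ∂p := by
  have hi := integrable_of_ae_mem_Icc hp
  have hc : Integrable (fun _ : ℝ => priorMean p) p := integrable_const _
  have e : ∀ x : ℝ, max (x - priorMean p) 0 = max (priorMean p - x) 0 + (x - priorMean p) := by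
    intro x; rcases le_total x (priorMean p) with h | h
    · rw [max_eq_right (by linarith), max_eq_left (by linarith)]; ring
    · rw [max_eq_left (by linarith), max_eq_right (by linarith)]; ring
  have h1 : Integrable (fun x : ℝ => max (priorMean p - x) 0) p := (hc.sub hi).pos_part
  have h2 : Integrable (fun x : ℝ => x - priorMean p) p := hi.sub hc
  simp_rw [e]
  rw [integral_add h1 h2, integral_sub hi hc]
  simp [priorMean]

/-- The mean absolute deviation of a truncated Gaussian is of order `σ`. -/
lemma le_integral_posPart_truncatedGaussian {ν σ : ℝ} (hν : ν ∈ Set.Icc (0 : ℝ) 1) (hσ : 0 < σ)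
    (hσ1 : σ ≤ 1) :
    σ / 64 ≤ ∫ x, max (x - priorMean (truncatedGaussian ν σ)) 0 ∂(truncatedGaussian ν σ) := by
  have := isProbabilityMeasure_truncatedGaussian hν hσ hσ1
  have hp := ae_truncatedGaussian_mem_Icc ν σ
  set p := truncatedGaussian ν σ with hpdef
  set m := priorMean p
  have hi := integrable_of_ae_mem_Icc hp
  have hc : Integrable (fun _ : ℝ => m) p := integrable_const _
  have habs : ∫ x, |x - m| ∂p = ∫ x, max (x - m) 0 ∂p + ∫ x, max (m - x) 0 ∂p := by
    have h1 : Integrable (fun x : ℝ => max (m - x) 0) p := (hc.sub hi).pos_part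
    have h2 : Integrable (fun x : ℝ => max (x - m) 0) p := (hi.sub hc).pos_part
    rw [← integral_add h2 h1]
    congr with x
    rcases le_total x m with h | h
    · rw [max_eq_right (by linarith), max_eq_left (by linarith), abs_of_nonpos (by linarith)]; ring
    · rw [max_eq_left (by linarith), max_eq_right (by linarith), abs_of_nonneg (by linarith)]; ring
  have h2 := integral_posPart_eq_integral_negPart hp
  -- The window has length `σ / 8`, hence mass at most `4 (σ / 8) / σ = 1 / 2`. Thus the mean
  -- absolute deviation is at least `σ / 32`, and the positive part accounts for half of it.
  have h3 : (p.real (Set.Icc (m - σ / 16) (m + σ / 16))) ≤ 1 / 2 := by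
    refine (truncatedGaussian_real_Icc_le hν hσ hσ1 (by linarith)).trans (le_of_eq ?_)
    field_simp; ring
  have h4 : (1 : ℝ) / 2 ≤ p.real (Set.Icc (m - σ / 16) (m + σ / 16))ᶜ := by
    rw [probReal_compl_eq_one_sub measurableSet_Icc]; linarith
  have h5 : σ / 16 * p.real (Set.Icc (m - σ / 16) (m + σ / 16))ᶜ ≤ ∫ x, |x - m| ∂p := by
    have hs : MeasurableSet (Set.Icc (m - σ / 16) (m + σ / 16))ᶜ := measurableSet_Icc.compl
    rw [← integral_indicator_one hs, ← integral_const_mul]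
    refine integral_mono (((integrable_const (1 : ℝ)).indicator hs).const_mul _)
      (hi.sub hc).abs fun x => ?_
    by_cases hx : x ∈ (Set.Icc (m - σ / 16) (m + σ / 16))ᶜ
    · simp only [Set.indicator_of_mem hx, Pi.one_apply, mul_one]
      by_contra hlt
      rw [not_le, abs_lt] at hlt
      exact hx ⟨by linarith, by linarith⟩
    · simp [Set.indicator_of_notMem hx]
  change σ / 64 ≤ ∫ x, max (x - m) 0 ∂p
  nlinarith

/-- The gap that two truncated Gaussians of variance `σ²` with centers at distance at most `d`
have with respect to each other's means. -/
def gaussGap (σ d : ℝ) : ℝ := Real.exp (-(σ⁻¹ * d) ^ 2) * (σ / 4 * (σ / 64)) ^ 2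

/-- Transfers the deviation of the prior centered at `ν'` from its own mean to the prior centered at
`ν`, by the change of center. -/
lemma gaussGap_le_posPart {ν ν' σ d : ℝ} (hν : ν ∈ Set.Icc (0 : ℝ) 1)
    (hν' : ν' ∈ Set.Icc (0 : ℝ) 1) (hσ : 0 < σ) (hσ1 : σ ≤ 1) (hd : |ν' - ν| ≤ d) :
    gaussGap σ d ≤
      ∫ x, max (x - priorMean (truncatedGaussian ν' σ)) 0 ∂(truncatedGaussian ν σ) := by
  have := isProbabilityMeasure_truncatedGaussian hν' hσ hσ1
  have hm := priorMean_mem_Icc (ae_truncatedGaussian_mem_Icc ν' σ)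
  refine le_trans ?_ (sq_integral_truncatedGaussian_le hν hν' hσ hσ1 (by fun_prop)
    (fun x _ => le_max_right _ _) fun x hx => max_le (by linarith [hx.2, hm.1]) zero_le_one)
  have := le_integral_posPart_truncatedGaussian hν' hσ hσ1
  unfold gaussGap
  gcongr

lemma gaussGap_le_negPart {ν ν' σ d : ℝ} (hν : ν ∈ Set.Icc (0 : ℝ) 1)
    (hν' : ν' ∈ Set.Icc (0 : ℝ) 1) (hσ : 0 < σ) (hσ1 : σ ≤ 1) (hd : |ν' - ν| ≤ d) :
    gaussGap σ d ≤
      ∫ x, max (priorMean (truncatedGaussian ν' σ) - x) 0 ∂(truncatedGaussian ν σ) := by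
  have := isProbabilityMeasure_truncatedGaussian hν' hσ hσ1
  have hp := ae_truncatedGaussian_mem_Icc ν' σ
  have hm := priorMean_mem_Icc hp
  refine le_trans ?_ (sq_integral_truncatedGaussian_le hν hν' hσ hσ1 (by fun_prop)
    (fun x _ => le_max_right _ _) fun x hx => max_le (by linarith [hx.1, hm.2]) zero_le_one)
  have := le_integral_posPart_truncatedGaussian hν' hσ hσ1
  rw [integral_posPart_eq_integral_negPart hp] at this
  unfold gaussGap
  gcongr

/-! ### The lower bound for well-separated truncated Gaussians -/

lemma spread_bddAbove {K : ℕ} (ν : Fin K → ℝ) :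
    BddAbove (Set.range fun p : Fin K × Fin K => |ν p.1 - ν p.2|) :=
  Set.finite_range _ |>.bddAbove

lemma abs_sub_le_spread {K : ℕ} (ν : Fin K → ℝ) (i j : Fin K) : |ν i - ν j| ≤ spread ν :=
  le_ciSup (spread_bddAbove ν) (i, j)

lemma exists_sub_eq_spread {K : ℕ} (ν : Fin K → ℝ) (h : 0 < spread ν) :
    ∃ i j, ν i - ν j = spread ν := by
  have hne : Nonempty (Fin K × Fin K) := by
    by_contra hne
    rw [not_nonempty_iff] at hne
    simp [spread, Real.iSup_of_isEmpty] at h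
  obtain ⟨⟨i, j⟩, hij⟩ := exists_eq_ciSup_of_finite (f := fun p : Fin K × Fin K => |ν p.1 - ν p.2|)
  change |ν i - ν j| = spread ν at hij
  rcases abs_cases (ν i - ν j) with ⟨h1, _⟩ | ⟨h1, _⟩
  · exact ⟨i, j, by linarith⟩
  · exact ⟨j, i, by linarith⟩

/-- Comparing arm `j` with arm `i` alone bounds the maximum over all mixtures from below. -/
lemma le_mainLowerBound {K : ℕ} (P : Fin K → Measure ℝ) (i j : Fin K) :
    (∫⁻ m, ENNReal.ofReal (m i - m j) ∂(Measure.pi P)) /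
      (∫⁻ m, ENNReal.ofReal (m j - m i) ∂(Measure.pi P)) ≤ mainLowerBound P := by
  have h : ∀ m : Fin K → ℝ, mixedMean (Pi.single i 1) m = m i := fun m => by
    simp [mixedMean, Pi.single_apply]
  have := le_iSup₂ (f := fun (j : Fin K) (q : Fin K → ℝ) => ⨆ _ : q ∈ stdSimplex ℝ (Fin K),
    (∫⁻ m, ENNReal.ofReal (mixedMean q m - m j) ∂(Measure.pi P)) /
      (∫⁻ m, ENNReal.ofReal (m j - mixedMean q m) ∂(Measure.pi P))) j (Pi.single i 1)
  refine le_trans ?_ this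
  refine le_trans (le_of_eq ?_) (le_iSup _ (single_mem_stdSimplex ℝ i))
  simp_rw [h]

/-- If the mean rewards of `i` and `j` are close to well-separated centers except on events of
total probability at most `τ`, then `mainLowerBound` is large. -/
lemma ratio_le_mainLowerBound {K : ℕ} {P : Fin K → Measure ℝ} [∀ i, IsProbabilityMeasure (P i)]
    (hP : ∀ i, ∀ᵐ x ∂P i, x ∈ Set.Icc (0 : ℝ) 1) {i j : Fin K} {a b d τ : ℝ} (hd : 0 < d)
    (hd1 : 4 * d ≤ 1) (hab : b - a = 4 * d) (hi : (P i).real {x | d ≤ |x - b|} ≤ τ)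
    (hj : (P j).real {x | d ≤ |x - a|} ≤ τ) (hτ0 : 0 < τ)
    (hτ : 2 * τ ≤ d) :
    ENNReal.ofReal (d / (2 * τ)) ≤ mainLowerBound P := by
  set Ti : Set (Fin K → ℝ) := (fun m => m i) ⁻¹' {x | d ≤ |x - b|}
  set Tj : Set (Fin K → ℝ) := (fun m => m j) ⁻¹' {x | d ≤ |x - a|}
  have hm : ∀ c : ℝ, MeasurableSet {x : ℝ | d ≤ |x - c|} := fun c =>
    measurableSet_le (by fun_prop) (by fun_prop)
  have hTi : Measure.pi P Ti = P i {x | d ≤ |x - b|} :=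
    (measurePreserving_eval P i).measure_preimage (hm b).nullMeasurableSet
  have hTj : Measure.pi P Tj = P j {x | d ≤ |x - a|} :=
    (measurePreserving_eval P j).measure_preimage (hm a).nullMeasurableSet
  have hTm : MeasurableSet (Ti ∪ Tj) :=
    ((measurable_pi_apply i) (hm b)).union ((measurable_pi_apply j) (hm a))
  have hT : Measure.pi P (Ti ∪ Tj) ≤ ENNReal.ofReal (2 * τ) := by
    refine (measure_union_le _ _).trans ?_
    rw [hTi, hTj, two_mul, ENNReal.ofReal_add hτ0.le hτ0.le]
    gcongr
    · rw [← ofReal_measureReal]; exact ENNReal.ofReal_le_ofReal hi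
    · rw [← ofReal_measureReal]; exact ENNReal.ofReal_le_ofReal hj
  have hsep : ∀ m ∉ Ti ∪ Tj, 2 * d ≤ m i - m j := by
    intro m hm
    simp only [Ti, Tj, Set.mem_union, Set.mem_preimage, Set.mem_ofPred_eq, not_or, not_le,
      abs_lt] at hm
    linarith [hm.1.1, hm.2.2]
  have hae : ∀ k, ∀ᵐ m ∂(Measure.pi P), m k ∈ Set.Icc (0 : ℝ) 1 := fun k =>
    (measurePreserving_eval P k).quasiMeasurePreserving.ae (hP k)
  have hden : ∫⁻ m, ENNReal.ofReal (m j - m i) ∂(Measure.pi P) ≤ ENNReal.ofReal (2 * τ) := by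
    refine le_trans ?_ hT
    rw [← lintegral_indicator_one hTm]
    refine lintegral_mono_ae ?_
    filter_upwards [hae i, hae j] with m hmi hmj
    by_cases h : m ∈ Ti ∪ Tj
    · rw [Set.indicator_of_mem h, Pi.one_apply, ENNReal.ofReal_le_one]
      linarith [hmi.1, hmj.2]
    · rw [Set.indicator_of_notMem h, nonpos_iff_eq_zero, ENNReal.ofReal_eq_zero]
      linarith [hsep m h]
  -- Pointwise, `2d` is at most the positive part of `m i - m j` plus the indicator of the bad
  -- event: outside that event by separation, inside it because `2d ≤ 1`. The bad event costs at
  -- most `2τ ≤ d`.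
  have hnum : ENNReal.ofReal d ≤ ∫⁻ m, ENNReal.ofReal (m i - m j) ∂(Measure.pi P) := by
    have h1 : ENNReal.ofReal d + ENNReal.ofReal d ≤
        ∫⁻ m, ENNReal.ofReal (m i - m j) ∂(Measure.pi P) + ENNReal.ofReal d := by
      calc ENNReal.ofReal d + ENNReal.ofReal d = ∫⁻ _, ENNReal.ofReal (2 * d) ∂(Measure.pi P) := by
            rw [← ENNReal.ofReal_add hd.le hd.le, ← two_mul]; simp
        _ ≤ ∫⁻ m, (ENNReal.ofReal (m i - m j) + (Ti ∪ Tj).indicator 1 m) ∂(Measure.pi P) := by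
          refine lintegral_mono fun m => ?_
          by_cases h : m ∈ Ti ∪ Tj
          · rw [Set.indicator_of_mem h, Pi.one_apply]
            exact le_add_left (ENNReal.ofReal_le_one.2 (by linarith))
          · rw [Set.indicator_of_notMem h, add_zero]
            exact ENNReal.ofReal_le_ofReal (hsep m h)
        _ = ∫⁻ m, ENNReal.ofReal (m i - m j) ∂(Measure.pi P) + Measure.pi P (Ti ∪ Tj) := by
          rw [lintegral_add_left (by fun_prop), lintegral_indicator_one hTm]
        _ ≤ _ := by
          gcongr
          exact hT.trans (ENNReal.ofReal_le_ofReal hτ)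
    exact ENNReal.le_of_add_le_add_right ENNReal.ofReal_ne_top h1
  refine le_trans ?_ (le_mainLowerBound P i j)
  rw [ENNReal.ofReal_div_of_pos (by positivity)]
  gcongr

/-- Below the threshold `σ₀` the term `L` is large by Gaussian tails; above it the target is at most
`2`, and two distinct arms suffice. -/
theorem exists_exp_le_lowerBoundRounds (c₀ : ℝ) (hc₀ : 0 < c₀) : ∃ c : ℝ, 0 < c ∧
    ∀ (K : ℕ) (ν : Fin K → ℝ) (σ : ℝ), (∀ i, ν i ∈ Set.Icc (0 : ℝ) 1) → 0 < σ → σ ^ 2 ≤ 1 →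
      c₀ ≤ spread ν → ENNReal.ofReal (Real.exp (c / σ ^ 2)) ≤
        lowerBoundRounds (fun i => truncatedGaussian (ν i) σ) := by
  set d₀ := c₀ / 4 with hd₀
  have hd₀pos : 0 < d₀ := by positivity
  set a := d₀ ^ 2 / 2 with ha
  have hapos : 0 < a := by positivity
  set σ₀ := d₀ * a / 16 with hσ₀
  have hσ₀pos : 0 < σ₀ := by positivity
  have hlog : 0 < Real.log 2 := Real.log_pos one_lt_two
  refine ⟨min (a / 2) (σ₀ ^ 2 * Real.log 2), by positivity, fun K ν σ hν hσ hσ1 hs => ?_⟩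
  have hσ1 : σ ≤ 1 := by nlinarith
  have hprob := fun i => isProbabilityMeasure_truncatedGaussian (hν i) hσ hσ1
  obtain ⟨i, j, hij⟩ := exists_sub_eq_spread ν (hc₀.trans_le hs)
  rcases le_total σ σ₀ with hle | hle
  · set d := spread ν / 4 with hd
    have hdd : d₀ ≤ d := by rw [hd, hd₀]; linarith
    have hdpos : 0 < d := hd₀pos.trans_le hdd
    have hexp : Real.exp (a / 2 / σ ^ 2) ≤ d₀ * σ / 8 * Real.exp (d ^ 2 / (2 * σ ^ 2)) := by
      have h1 : Real.exp (a / 2 / σ ^ 2) * Real.exp (a / 2 / σ ^ 2) ≤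
          Real.exp (d ^ 2 / (2 * σ ^ 2)) := by
        rw [← Real.exp_add, Real.exp_le_exp, ha]
        have : d₀ ^ 2 ≤ d ^ 2 := pow_le_pow_left₀ hd₀pos.le hdd 2
        rw [show d₀ ^ 2 / 2 / 2 / σ ^ 2 + d₀ ^ 2 / 2 / 2 / σ ^ 2 = d₀ ^ 2 / (2 * σ ^ 2) by
          field_simp; ring]
        gcongr
      have h2 : a / 2 / σ ^ 2 ≤ Real.exp (a / 2 / σ ^ 2) := by
        linarith [Real.add_one_le_exp (a / 2 / σ ^ 2)]
      -- This is where `σ₀ = d₀ a / 16` comes from. One half of the exponent absorbs the polynomial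
      -- prefactor `d₀ σ / 8`, and the other half is the claimed growth.
      have h3 : 1 ≤ d₀ * σ / 8 * (a / 2 / σ ^ 2) := by
        rw [show d₀ * σ / 8 * (a / 2 / σ ^ 2) = σ₀ / σ by rw [hσ₀]; field_simp; ring]
        exact (one_le_div hσ).2 hle
      have h4 := Real.exp_pos (a / 2 / σ ^ 2)
      calc Real.exp (a / 2 / σ ^ 2) ≤ d₀ * σ / 8 * (a / 2 / σ ^ 2) * Real.exp (a / 2 / σ ^ 2) :=
            le_mul_of_one_le_left h4.le h3
        _ ≤ d₀ * σ / 8 * Real.exp (a / 2 / σ ^ 2) * Real.exp (a / 2 / σ ^ 2) := by gcongr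
        _ = d₀ * σ / 8 * (Real.exp (a / 2 / σ ^ 2) * Real.exp (a / 2 / σ ^ 2)) := by ring
        _ ≤ _ := by gcongr
    set τ := 4 / σ * Real.exp (-d ^ 2 / (2 * σ ^ 2)) with hτ
    have hτpos : 0 < τ := by positivity
    have hratio : d / (2 * τ) = d * σ / 8 * Real.exp (d ^ 2 / (2 * σ ^ 2)) := by
      rw [hτ, neg_div, Real.exp_neg]; field_simp; norm_num
    have hbig : Real.exp (a / 2 / σ ^ 2) ≤ d / (2 * τ) := by
      rw [hratio]; refine hexp.trans ?_; gcongr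
    have h := ratio_le_mainLowerBound (P := fun i => truncatedGaussian (ν i) σ)
      (fun i => ae_truncatedGaussian_mem_Icc (ν i) σ) (i := i) (j := j) (a := ν j) (b := ν i)
      hdpos (by rw [hd]; linarith [(hν i).2, (hν j).1]) (by rw [hij, hd]; ring)
      (truncatedGaussian_real_tail_le (hν i) hσ hσ1 hdpos.le)
      (truncatedGaussian_real_tail_le (hν j) hσ hσ1 hdpos.le) hτpos (by
        rw [← one_le_div (by positivity)]
        exact (Real.one_le_exp (by positivity)).trans hbig)
    refine le_trans (ENNReal.ofReal_le_ofReal (le_trans ?_ hbig)) (h.trans ?_)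
    · gcongr; exact min_le_left _ _
    · exact (le_max_right _ _).trans (le_max_right _ _)
  -- Large `σ`: the second term in the minimum defining `c` forces `exp (c / σ²) ≤ 2`.
  · have hK : 2 ≤ K := by
      have hne : i ≠ j := by rintro rfl; linarith [sub_self (ν i)]
      have := Fin.val_ne_of_ne hne
      omega
    refine le_trans ?_ (le_max_left _ _)
    rw [show (K : ℝ≥0∞) = ENNReal.ofReal (K : ℝ) by simp]
    refine ENNReal.ofReal_le_ofReal (le_trans ?_ (show (2 : ℝ) ≤ K by exact_mod_cast hK))
    rw [← Real.le_log_iff_exp_le two_pos, div_le_iff₀ (by positivity), mul_comm]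
    refine (min_le_right _ _).trans ?_
    gcongr

/-! ### The number of samples for Thompson Sampling -/

/-- Priors on `[0, 1]` such that each mean reward exceeds each prior mean, and falls below it, by
at least `ε` on average. -/
structure HasGap {K : ℕ} (P : Fin K → Measure ℝ) (ε : ℝ) : Prop where
  isProbabilityMeasure : ∀ i, IsProbabilityMeasure (P i)
  mem_Icc : ∀ i, ∀ᵐ x ∂P i, x ∈ Set.Icc (0 : ℝ) 1
  pos : 0 < ε
  le_posPart : ∀ i j, ε ≤ ∫ x, max (x - priorMean (P j)) 0 ∂P i
  le_negPart : ∀ i j, ε ≤ ∫ x, max (priorMean (P j) - x) 0 ∂P i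

namespace HasGap

variable {K : ℕ} {P : Fin K → Measure ℝ} {ε : ℝ}

lemma mono (h : HasGap P ε) {δ : ℝ} (hδ : 0 < δ) (hle : δ ≤ ε) : HasGap P δ :=
  ⟨h.isProbabilityMeasure, h.mem_Icc, hδ, fun i j => hle.trans (h.le_posPart i j),
    fun i j => hle.trans (h.le_negPart i j)⟩

lemma priorMean_mem (h : HasGap P ε) (i : Fin K) : priorMean (P i) ∈ Set.Icc (0 : ℝ) 1 :=
  have := h.isProbabilityMeasure i
  priorMean_mem_Icc (h.mem_Icc i)

lemma le_real_gt (h : HasGap P ε) (i j : Fin K) : ε ≤ (P i).real {x | priorMean (P j) < x} := by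
  have := h.isProbabilityMeasure i
  have hs : MeasurableSet {x : ℝ | priorMean (P j) < x} := measurableSet_lt (by fun_prop) (by fun_prop)
  refine (h.le_posPart i j).trans ?_
  rw [← integral_indicator_one hs]
  refine integral_mono_ae
    ((integrable_of_ae_mem_Icc (h.mem_Icc i)).sub (integrable_const _)).pos_part
    ((integrable_const _).indicator hs) ((h.mem_Icc i).mono fun x hx => ?_)
  have := (h.priorMean_mem j).1
  by_cases hx' : priorMean (P j) < x
  · simp only [Set.indicator_of_mem (show x ∈ {x : ℝ | priorMean (P j) < x} from hx'), Pi.one_apply]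
    exact max_le (by linarith [hx.2]) zero_le_one
  · rw [Set.indicator_of_notMem (by exact hx')]
    exact max_le (by linarith) le_rfl

lemma le_real_lt (h : HasGap P ε) (i j : Fin K) : ε ≤ (P i).real {x | x < priorMean (P j)} := by
  have := h.isProbabilityMeasure i
  have hs : MeasurableSet {x : ℝ | x < priorMean (P j)} := measurableSet_lt (by fun_prop) (by fun_prop)
  refine (h.le_negPart i j).trans ?_
  rw [← integral_indicator_one hs]
  refine integral_mono_ae
    ((integrable_const _).sub (integrable_of_ae_mem_Icc (h.mem_Icc i))).pos_part
    ((integrable_const _).indicator hs) ((h.mem_Icc i).mono fun x hx => ?_)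
  have := (h.priorMean_mem j).2
  by_cases hx' : x < priorMean (P j)
  · simp only [Set.indicator_of_mem (show x ∈ {x : ℝ | x < priorMean (P j)} from hx'), Pi.one_apply]
    exact max_le (by linarith [hx.1]) zero_le_one
  · rw [Set.indicator_of_notMem (by exact hx')]
    exact max_le (by linarith) le_rfl

/-- Arm `i` is best if it exceeds its own prior mean and every other arm falls below that value.
These `K` events are independent, each of probability at least `ε`. -/
lemma pow_le_deltaTS (h : HasGap P ε) (hK : 0 < K) : ε ^ K ≤ deltaTS P := by
  have := h.isProbabilityMeasure
  have : Nonempty (Fin K) := ⟨⟨0, hK⟩⟩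
  refine le_ciInf fun i => ?_
  set M := priorMean (P i)
  set S : Fin K → Set ℝ := fun j => if j = i then {x | M < x} else {x | x < M}
  have hsub : Set.univ.pi S ⊆ isBest P i := by
    intro m hm j hj
    have hi := hm i trivial
    have hj' := hm j trivial
    simp only [S, if_true, if_neg hj, Set.mem_ofPred_eq] at hi hj'
    exact Or.inl (hj'.trans hi)
  calc ε ^ K = ∏ _j : Fin K, ε := by simp
    _ ≤ ∏ j, (P j).real (S j) := by
      refine Finset.prod_le_prod (fun _ _ => h.pos.le) fun j _ => ?_
      by_cases hj : j = i
      · simpa [S, hj] using h.le_real_gt i i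
      · simpa [S, hj] using h.le_real_lt j i
    _ = (Measure.pi P).real (Set.univ.pi S) := by
      simp [Measure.real, Measure.pi_pi, ENNReal.toReal_prod]
    _ ≤ _ := measureReal_mono hsub

/-- With `M` the prior mean of arm `j`, the positive part of `μ_i - μ_j` is at least `(μ_i - M)₊ +
1{μ_i > M} (M - μ_j)`, and the second term has expectation zero by independence. -/
lemma le_epsTS (h : HasGap P ε) (hK : 2 ≤ K) : ε ≤ epsTS P := by
  have := h.isProbabilityMeasure
  have : Nonempty {p : Fin K × Fin K // p.1 ≠ p.2} :=
    ⟨⟨(⟨0, by omega⟩, ⟨1, by omega⟩), by simp [Fin.ext_iff]⟩⟩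
  refine le_ciInf fun ⟨⟨i, j⟩, hij⟩ => ?_
  change i ≠ j at hij
  change ε ≤ ∫ m, max (m i - m j) 0 ∂(Measure.pi P)
  set M := priorMean (P j) with hM
  have hae : ∀ k, ∀ᵐ m ∂(Measure.pi P), m k ∈ Set.Icc (0 : ℝ) 1 := fun k =>
    (measurePreserving_eval P k).quasiMeasurePreserving.ae (h.mem_Icc k)
  have hint : ∀ k, Integrable (fun m : Fin K → ℝ => m k) (Measure.pi P) := fun k =>
    integrable_comp_eval (X := fun _ => ℝ) (i := k) (f := fun x : ℝ => x) (integrable_of_ae_mem_Icc (h.mem_Icc k))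
  have hs : MeasurableSet {x : ℝ | M < x} := measurableSet_lt (by fun_prop) (by fun_prop)
  have hind : IndepFun (fun m : Fin K → ℝ => {x : ℝ | M < x}.indicator (fun _ => (1 : ℝ)) (m i))
      (fun m => M - m j) (Measure.pi P) :=
    ((iIndepFun_pi (μ := P) (X := fun _ x => x) (fun _ => by fun_prop)).indepFun hij).comp
      (φ := {x : ℝ | M < x}.indicator fun _ => (1 : ℝ)) (ψ := fun x => M - x)
      (measurable_const.indicator hs) (by fun_prop)
  have hzero : ∫ m, {x : ℝ | M < x}.indicator (fun _ => (1 : ℝ)) (m i) * (M - m j)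
      ∂(Measure.pi P) = 0 := by
    rw [hind.integral_fun_mul_eq_mul_integral
      ((measurable_const.indicator hs).comp (measurable_pi_apply i)).aestronglyMeasurable
      (measurable_const.sub (measurable_pi_apply j)).aestronglyMeasurable,
      integral_sub (integrable_const _) (hint j)]
    have : ∫ m, m j ∂(Measure.pi P) = M :=
      integral_comp_eval (μ := P) (i := j) (f := fun x => x) (by fun_prop)
    simp [this]
  have hpos : ∫ m, max (m i - M) 0 ∂(Measure.pi P) = ∫ x, max (x - M) 0 ∂P i :=
    integral_comp_eval (μ := P) (i := i) (f := fun x => max (x - M) 0) (by fun_prop)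
  have hi1 : Integrable (fun m : Fin K → ℝ => max (m i - M) 0) (Measure.pi P) :=
    ((hint i).sub (integrable_const M)).pos_part
  have hi2 : Integrable (fun m : Fin K → ℝ =>
      {x : ℝ | M < x}.indicator (fun _ => (1 : ℝ)) (m i) * (M - m j)) (Measure.pi P) := by
    refine Integrable.bdd_mul (c := 1) ((integrable_const M).sub (hint j))
      ((measurable_const.indicator hs).comp (measurable_pi_apply i)).aestronglyMeasurable
      (Filter.Eventually.of_forall fun m => ?_)
    by_cases hm : M < m i <;> simp [Set.indicator, hm]
  calc ε ≤ ∫ x, max (x - M) 0 ∂P i := h.le_posPart i j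
    _ = ∫ m, (max (m i - M) 0 + {x : ℝ | M < x}.indicator (fun _ => (1 : ℝ)) (m i) * (M - m j))
        ∂(Measure.pi P) := by rw [integral_add hi1 hi2, hzero, hpos, add_zero]
    _ ≤ _ := by
      refine integral_mono (hi1.add hi2) ((hint i).sub (hint j)).pos_part fun m => ?_
      by_cases hm : M < m i
      · simp only [Set.indicator, Set.mem_ofPred_eq, hm, if_true, one_mul]
        rw [max_eq_left (by linarith)]
        exact le_trans (by linarith) (le_max_left _ _)
      · simp only [Set.indicator, Set.mem_ofPred_eq, hm, if_false, zero_mul]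
        rw [max_eq_right (by linarith), add_zero]
        exact le_max_right _ _

lemma samplesTS_le (h : HasGap P ε) (hK : 0 < K) {C : ℝ} (hC : 0 < C) :
    (samplesTS C P : ℝ) ≤ C * (ε⁻¹) ^ 3 * K + 1 := by
  have := h.isProbabilityMeasure
  have hε := h.pos
  have hnn : 0 ≤ C * (ε⁻¹) ^ 3 * K := by positivity
  rcases Nat.lt_or_ge K 2 with hlt | hge
  -- For one arm, `epsTS` is an infimum over the empty type, hence `0`; as `0⁻¹ = 0`, so is the
  -- number of samples.
  · obtain rfl : K = 1 := by omega
    have : IsEmpty {p : Fin 1 × Fin 1 // p.1 ≠ p.2} := ⟨fun p => p.2 (Subsingleton.elim _ _)⟩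
    have h0 : epsTS P = 0 := by rw [epsTS, Real.iInf_of_isEmpty]
    simp only [samplesTS, h0]
    norm_num
    positivity
  have hδ := h.pow_le_deltaTS hK
  have hδpos : 0 < deltaTS P := lt_of_lt_of_le (by positivity) hδ
  have heps := h.le_epsTS hge
  have hepspos : 0 < epsTS P := hε.trans_le heps
  have hlog0 : Real.log (deltaTS P)⁻¹ ≤ K * ε⁻¹ := by
    calc Real.log (deltaTS P)⁻¹ ≤ Real.log ((ε ^ K)⁻¹) := by gcongr
      _ = K * Real.log ε⁻¹ := by rw [← inv_pow, Real.log_pow]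
      _ ≤ K * ε⁻¹ := by
        gcongr
        exact (Real.log_le_sub_one_of_pos (by positivity)).trans (by linarith)
  have hle : C * (epsTS P)⁻¹ ^ 2 * Real.log (deltaTS P)⁻¹ ≤ C * (ε⁻¹) ^ 3 * K := by
    calc C * (epsTS P)⁻¹ ^ 2 * Real.log (deltaTS P)⁻¹
        ≤ C * (epsTS P)⁻¹ ^ 2 * (K * ε⁻¹) := by gcongr
      _ ≤ C * (ε⁻¹) ^ 2 * (K * ε⁻¹) := by gcongr
      _ = _ := by ring
  calc (samplesTS C P : ℝ) ≤ (⌈C * (ε⁻¹) ^ 3 * K⌉₊ : ℝ) := by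
        exact_mod_cast Nat.ceil_mono hle
    _ ≤ _ := (Nat.ceil_lt_add_one hnn).le

end HasGap

/-- Truncated Gaussians have a polynomial gap. -/
lemma hasGap_truncatedGaussian {K : ℕ} {ν : Fin K → ℝ} {σ : ℝ}
    (hν : ∀ i, ν i ∈ Set.Icc (0 : ℝ) 1) (hσ : 0 < σ) (hσ1 : σ ≤ 1) :
    HasGap (fun i => truncatedGaussian (ν i) σ) (gaussGap σ (spread ν)) where
  isProbabilityMeasure i := isProbabilityMeasure_truncatedGaussian (hν i) hσ hσ1
  mem_Icc i := ae_truncatedGaussian_mem_Icc _ _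
  pos := by unfold gaussGap; positivity
  le_posPart i j := gaussGap_le_posPart (hν i) (hν j) hσ hσ1 (abs_sub_le_spread ν j i)
  le_negPart i j := gaussGap_le_negPart (hν i) (hν j) hσ hσ1 (abs_sub_le_spread ν j i)

/-! ### The environment, arm by arm -/

/-- The law of the mean reward of an arm together with the numbers that decide its samples. -/
def armLaw (p : Measure ℝ) : Measure (ℝ × (ℕ → unitInterval)) :=
  p.prod (Measure.infinitePi fun _ : ℕ => (volume : Measure unitInterval))

instance (p : Measure ℝ) [IsProbabilityMeasure p] : IsProbabilityMeasure (armLaw p) := by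
  unfold armLaw; infer_instance

instance {K : ℕ} (P : Fin K → Measure ℝ) [∀ i, IsProbabilityMeasure (P i)] :
    IsProbabilityMeasure (envLaw P) := by
  unfold envLaw; infer_instance

/-- The part of the environment that concerns arm `i`. -/
def armData {K : ℕ} (e : Env K) (i : Fin K) : ℝ × (ℕ → unitInterval) :=
  (e.1 i, fun n => e.2 (i, n))

/-- The samples of an arm. -/
def armSample (w : ℝ × (ℕ → unitInterval)) (n : ℕ) : Bool := decide ((w.2 n : ℝ) < w.1)

lemma sample_eq_armSample {K : ℕ} (e : Env K) (i : Fin K) : sample e i = armSample (armData e i) :=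
  rfl

/-- The arms are independent. -/
lemma measurePreserving_armData {K : ℕ} (P : Fin K → Measure ℝ) [∀ i, IsProbabilityMeasure (P i)] :
    MeasurePreserving (fun e : Env K => armData e) (envLaw P)
      (Measure.pi fun i => armLaw (P i)) := by
  have h1 : MeasurePreserving (MeasurableEquiv.curry (Fin K) ℕ unitInterval)
      (Measure.infinitePi fun _ : Fin K × ℕ => (volume : Measure unitInterval))
      (Measure.pi fun _ : Fin K => Measure.infinitePi fun _ : ℕ => (volume : Measure unitInterval)) := by
    refine ⟨MeasurableEquiv.measurable _, ?_⟩
    rw [Measure.infinitePi_map_curry (fun (_ : Fin K) (_ : ℕ) => (volume : Measure unitInterval)),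
      Measure.infinitePi_eq_pi]
  exact ((measurePreserving_arrowProdEquivProdArrow ℝ (ℕ → unitInterval) (Fin K) P
    fun _ => Measure.infinitePi fun _ : ℕ => (volume : Measure unitInterval)).symm).comp
    ((MeasurePreserving.id _).prod h1)

lemma ae_armLaw_fst {p : Measure ℝ} [IsProbabilityMeasure p]
    (hp : ∀ᵐ x ∂p, x ∈ Set.Icc (0 : ℝ) 1) : ∀ᵐ w ∂armLaw p, w.1 ∈ Set.Icc (0 : ℝ) 1 :=
  Measure.quasiMeasurePreserving_fst.ae hp

lemma integral_armLaw_fst (p : Measure ℝ) [IsProbabilityMeasure p] (f : ℝ → ℝ) :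
    ∫ w, f w.1 ∂armLaw p = ∫ x, f x ∂p := by
  rw [armLaw, integral_fun_fst]; simp

lemma ae_envLaw_fst {K : ℕ} {P : Fin K → Measure ℝ} [∀ i, IsProbabilityMeasure (P i)]
    (hP : ∀ i, ∀ᵐ x ∂P i, x ∈ Set.Icc (0 : ℝ) 1) :
    ∀ᵐ e ∂envLaw P, ∀ i, e.1 i ∈ Set.Icc (0 : ℝ) 1 := by
  rw [ae_all_iff]
  intro i
  have h : ∀ᵐ m ∂Measure.pi P, m i ∈ Set.Icc (0 : ℝ) 1 :=
    (measurePreserving_eval P i).quasiMeasurePreserving.ae (hP i)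
  exact Measure.quasiMeasurePreserving_fst.ae h

/-- Independence of the arms: the expectation of `∏ᵢ φᵢ · (μ_j - μ_k)`, where `φᵢ` depends on
arm `i` only, if the weight `φ_k` does not favor the arm `k` over `c`, and `φ_j` favors the arm `j`
over `c`. -/
lemma le_integral_prod_mul_sub {K : ℕ} {P : Fin K → Measure ℝ} [∀ i, IsProbabilityMeasure (P i)]
    (hP : ∀ i, ∀ᵐ x ∂P i, x ∈ Set.Icc (0 : ℝ) 1) {φ : Fin K → ℝ × (ℕ → unitInterval) → ℝ}
    (hφ : ∀ i, Measurable (φ i)) (hφ0 : ∀ i w, 0 ≤ φ i w) (hφ1 : ∀ i w, φ i w ≤ 1)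
    {j k : Fin K} (hjk : j ≠ k) {c γ : ℝ}
    (hk : ∫ w, φ k w * w.1 ∂armLaw (P k) ≤ c * ∫ w, φ k w ∂armLaw (P k))
    (hj : c * ∫ w, φ j w ∂armLaw (P j) + γ ≤ ∫ w, φ j w * w.1 ∂armLaw (P j)) :
    γ * ∏ i ∈ Finset.univ \ {j}, ∫ w, φ i w ∂armLaw (P i) ≤
      ∫ e, (∏ i, φ i (armData e i)) * (e.1 j - e.1 k) ∂envLaw P := by
  have hint : ∀ l, Integrable (fun e : Env K => (∏ i, φ i (armData e i)) * e.1 l) (envLaw P) := by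
    intro l
    refine Integrable.of_bound (Measurable.aestronglyMeasurable ?_) 1 ?_
    · refine (Finset.measurable_prod _ fun i _ => (hφ i).comp ?_).mul (by fun_prop)
      unfold armData; fun_prop
    · filter_upwards [ae_envLaw_fst hP] with e he
      have h0 := Finset.prod_nonneg fun i (_ : i ∈ Finset.univ) => hφ0 i (armData e i)
      have h1 : ∏ i, φ i (armData e i) ≤ 1 :=
        Finset.prod_le_one (fun i _ => hφ0 i _) fun i _ => hφ1 i _
      rw [Real.norm_eq_abs, abs_of_nonneg (mul_nonneg h0 (he l).1)]
      exact mul_le_one₀ h1 (he l).1 (he l).2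
  have hprod : ∀ l, ∫ e, (∏ i, φ i (armData e i)) * e.1 l ∂envLaw P =
      (∫ w, φ l w * w.1 ∂armLaw (P l)) * ∏ i ∈ Finset.univ \ {l}, ∫ w, φ i w ∂armLaw (P i) := by
    intro l
    -- Absorbing the factor `e.1 l` into the weight of arm `l` keeps the integrand a product over
    -- independent arms.
    set ψ := Function.update φ l fun w => φ l w * w.1 with hψ
    have hψm : ∀ i, Measurable (ψ i) := by
      intro i
      by_cases hi : i = l
      · subst hi; simp only [hψ, Function.update_self]; exact (hφ i).mul measurable_fst
      · simp only [hψ, Function.update_of_ne hi]; exact hφ i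
    have e1 : ∀ e : Env K, (∏ i, φ i (armData e i)) * e.1 l = ∏ i, ψ i (armData e i) := by
      intro e
      have : (fun i => ψ i (armData e i)) = Function.update (fun i => φ i (armData e i)) l
          (φ l (armData e l) * e.1 l) := by
        funext i
        by_cases hi : i = l
        · subst hi; simp [hψ, armData]
        · simp [hψ, hi]
      rw [this, Finset.prod_update_of_mem (Finset.mem_univ l),
        ← Finset.prod_sdiff (Finset.subset_univ {l})]
      simp; ring
    simp_rw [e1]
    have h2 := integral_map (f := fun W : Fin K → ℝ × (ℕ → unitInterval) => ∏ i, ψ i (W i))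
      (measurePreserving_armData P).aemeasurable
      (Finset.measurable_prod _ fun i _ => (hψm i).comp (measurable_pi_apply i)).aestronglyMeasurable
    rw [(measurePreserving_armData P).map_eq, integral_fintype_prod_eq_prod] at h2
    rw [← h2]
    have : (fun i => ∫ w, ψ i w ∂armLaw (P i)) =
        Function.update (fun i => ∫ w, φ i w ∂armLaw (P i)) l (∫ w, φ l w * w.1 ∂armLaw (P l)) := by
      funext i
      by_cases hi : i = l
      · subst hi; simp [hψ]
      · simp [hψ, hi]
    rw [this, Finset.prod_update_of_mem (Finset.mem_univ l)]
  set a := fun i => ∫ w, φ i w ∂armLaw (P i) with ha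
  have ha0 : ∀ i, 0 ≤ a i := fun i => integral_nonneg (hφ0 i)
  set rest := ∏ i ∈ Finset.univ \ {j, k}, a i
  have hrest : 0 ≤ rest := Finset.prod_nonneg fun i _ => ha0 i
  have hsj : ∏ i ∈ Finset.univ \ {j}, a i = a k * rest := by
    rw [show Finset.univ \ {j} = insert k (Finset.univ \ {j, k}) by
        ext i; by_cases h : i = k
        · simp [h, hjk.symm]
        · simp [h],
      Finset.prod_insert (by simp)]
  have hsk : ∏ i ∈ Finset.univ \ {k}, a i = a j * rest := by
    rw [show Finset.univ \ {k} = insert j (Finset.univ \ {j, k}) by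
        ext i; by_cases h : i = j
        · simp [h, hjk]
        · simp [h],
      Finset.prod_insert (by simp)]
  simp_rw [mul_sub]
  rw [integral_sub (hint j) (hint k), hprod j, hprod k]
  change γ * ∏ i ∈ Finset.univ \ {j}, a i ≤
    _ * ∏ i ∈ Finset.univ \ {j}, a i - _ * ∏ i ∈ Finset.univ \ {k}, a i
  rw [hsj, hsk]
  -- Both products share the factor `rest`. Comparing each mean reward with `c`, the terms `c * a j
  -- * a k * rest` cancel and leave `γ * a k * rest`.
  have h1 : (∫ w, φ k w * w.1 ∂armLaw (P k)) * (a j * rest) ≤ c * a k * (a j * rest) :=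
    mul_le_mul_of_nonneg_right hk (mul_nonneg (ha0 j) hrest)
  have h2 : (c * a j + γ) * (a k * rest) ≤ (∫ w, φ j w * w.1 ∂armLaw (P j)) * (a k * rest) :=
    mul_le_mul_of_nonneg_right hj (mul_nonneg (ha0 k) hrest)
  nlinarith

/-! ### Empirical means -/

/-- The number of successes among the first `n` samples. -/
def successes (n : ℕ) (d : ℕ → Bool) : ℝ := ∑ k ∈ Finset.range n, if d k then 1 else 0

lemma measurable_armSample (n : ℕ) : Measurable fun w => armSample w n :=
  measurable_to_bool (by
    have : (fun w => armSample w n) ⁻¹' {true} =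
        {w : ℝ × (ℕ → unitInterval) | (w.2 n : ℝ) < w.1} := by ext w; simp [armSample]
    rw [this]
    exact measurableSet_lt (by fun_prop) (by fun_prop))

lemma measurable_successes (n : ℕ) : Measurable fun w => successes n (armSample w) := by
  refine Finset.measurable_sum _ fun k _ => Measurable.ite ?_ measurable_const measurable_const
  exact measurable_armSample k (measurableSet_singleton true)

lemma successes_nonneg (n : ℕ) (d : ℕ → Bool) : 0 ≤ successes n d :=
  Finset.sum_nonneg fun _ _ => by split_ifs <;> norm_num

lemma successes_le (n : ℕ) (d : ℕ → Bool) : successes n d ≤ n := by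
  calc successes n d ≤ ∑ _k ∈ Finset.range n, (1 : ℝ) :=
        Finset.sum_le_sum fun _ _ => by split_ifs <;> norm_num
    _ = n := by simp

/-- The left side is the variance of a sum of `n` independent variables in `[0, 1]`, each of
variance at most `1 / 4`. -/
lemma integral_sq_successes_sub_le {m : ℝ} (hm : m ∈ Set.Icc (0 : ℝ) 1) (n : ℕ) :
    ∫ ω, (successes n (armSample (m, ω)) - n * m) ^ 2
      ∂(Measure.infinitePi fun _ : ℕ => (volume : Measure unitInterval)) ≤ n / 4 := by
  set Q := Measure.infinitePi fun _ : ℕ => (volume : Measure unitInterval)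
  let f : unitInterval → ℝ := fun u => if (u : ℝ) < m then 1 else 0
  let X : ℕ → (ℕ → unitInterval) → ℝ := fun k ω => f (ω k)
  have hf : Measurable f := Measurable.ite (measurableSet_lt (by fun_prop) (by fun_prop))
    measurable_const measurable_const
  have hXm : ∀ k, Measurable (X k) := fun k => hf.comp (measurable_pi_apply k)
  have hXb : ∀ k ω, X k ω ∈ Set.Icc (0 : ℝ) 1 := by
    intro k ω; simp only [X, f]; split_ifs <;> simp
  have hL : ∀ k, MemLp (X k) 2 Q := fun k => MemLp.of_bound (hXm k).aestronglyMeasurable 1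
    (Filter.Eventually.of_forall fun ω => by
      rw [Real.norm_eq_abs, abs_of_nonneg (hXb k ω).1]; exact (hXb k ω).2)
  have hE : ∀ k, ∫ ω, X k ω ∂Q = m := by
    intro k
    have h1 : ∫ ω, X k ω ∂Q = ∫ u, f u := by
      rw [← (measurePreserving_eval_infinitePi (fun _ : ℕ => (volume : Measure unitInterval)) k).map_eq,
        integral_map (measurable_pi_apply k).aemeasurable hf.aestronglyMeasurable]
    rw [h1]
    have h2 : f = (Set.Iio (⟨m, hm⟩ : unitInterval)).indicator 1 := by
      funext u; simp [f, Set.indicator, ← Subtype.coe_lt_coe]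
    rw [h2, integral_indicator_one measurableSet_Iio, Measure.real, unitInterval.volume_Iio]
    simp [hm.1]
  have hsum : ∀ ω, successes n (armSample (m, ω)) = (∑ k ∈ Finset.range n, X k) ω := by
    intro ω; simp [successes, armSample, X, f]
  have hEs : ∫ ω, (∑ k ∈ Finset.range n, X k) ω ∂Q = n * m := by
    simp_rw [Finset.sum_apply]
    rw [integral_finsetSum _ fun k _ => (hL k).integrable (by norm_num)]
    simp [hE]
  have hvar : Var[∑ k ∈ Finset.range n, X k; Q] ≤ n / 4 := by
    rw [IndepFun.variance_sum (fun k _ => hL k) (fun i _ j _ hij =>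
      (iIndepFun_infinitePi (P := fun _ : ℕ => (volume : Measure unitInterval))
        (X := fun _ => f) fun _ => hf).indepFun hij)]
    calc ∑ k ∈ Finset.range n, Var[X k; Q] ≤ ∑ _k ∈ Finset.range n, (1 / 4 : ℝ) :=
          Finset.sum_le_sum fun k _ => (variance_le_sq_of_bounded
            (Filter.Eventually.of_forall (hXb k)) (hXm k).aemeasurable).trans (by norm_num)
      _ = n / 4 := by simp; ring
  rw [variance_eq_integral (Finset.aemeasurable_sum _ fun k _ => (hXm k).aemeasurable), hEs] at hvar
  simpa [hsum] using hvar

/-- With `e²` samples the mean squared error is at most `1 / (4 e²)`. Taking `e = a` later makes the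
absolute error half of a gap `1 / a`. -/
lemma integral_abs_successes_sub_le {p : Measure ℝ} [IsProbabilityMeasure p]
    (hp : ∀ᵐ x ∂p, x ∈ Set.Icc (0 : ℝ) 1) {e : ℕ} (he : 0 < e) :
    ∫ w, |successes (e ^ 2) (armSample w) / e ^ 2 - w.1| ∂armLaw p ≤ 1 / (2 * e) := by
  have he' : (0 : ℝ) < e := by exact_mod_cast he
  set g : ℝ × (ℕ → unitInterval) → ℝ := fun w => (successes (e ^ 2) (armSample w) / e ^ 2 - w.1)
    with hg
  have hgm : Measurable g := ((measurable_successes _).div_const _).sub measurable_fst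
  have hgb : ∀ᵐ w ∂armLaw p, |g w| ≤ 1 := by
    filter_upwards [ae_armLaw_fst hp] with w hw
    have h1 : successes (e ^ 2) (armSample w) / e ^ 2 ≤ 1 := by
      rw [div_le_one (by positivity)]
      exact_mod_cast successes_le (e ^ 2) (armSample w)
    have h2 : 0 ≤ successes (e ^ 2) (armSample w) / e ^ 2 :=
      div_nonneg (successes_nonneg _ _) (by positivity)
    rw [abs_le]; constructor <;> linarith [hw.1, hw.2]
  have hgi : Integrable (fun w => |g w|) (armLaw p) :=
    Integrable.of_bound (by fun_prop) 1 (hgb.mono fun w hw => by simpa using hw)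
  have hg2i : Integrable (fun w => g w ^ 2) (armLaw p) :=
    Integrable.of_bound (by fun_prop) 1 (hgb.mono fun w hw => by
      rw [Real.norm_eq_abs, abs_pow]; exact pow_le_one₀ (abs_nonneg _) hw)
  have hsq : ∫ w, g w ^ 2 ∂armLaw p ≤ 1 / (4 * e ^ 2) := by
    rw [armLaw, integral_prod _ hg2i]
    calc _ ≤ ∫ _, (1 / (4 * e ^ 2) : ℝ) ∂p := by
          refine integral_mono_ae hg2i.integral_prod_left (integrable_const _) ?_
          filter_upwards [hp] with m hm
          have h1 := integral_sq_successes_sub_le hm (e ^ 2)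
          have h2 : ∀ ω, g (m, ω) ^ 2 = (1 / (e : ℝ) ^ 4) *
              (successes (e ^ 2) (armSample (m, ω)) - (e ^ 2 : ℕ) * m) ^ 2 := by
            intro ω; simp only [hg]; push_cast; field_simp
          simp_rw [h2]
          rw [integral_const_mul]
          calc _ ≤ (1 / (e : ℝ) ^ 4) * ((e ^ 2 : ℕ) / 4) := by gcongr
            _ = _ := by push_cast; field_simp
      _ = _ := by simp
  -- The bound `|g| ≤ e g² + 1 / (4e)` (AM-GM) replaces Cauchy-Schwarz.
  calc ∫ w, |g w| ∂armLaw p ≤ ∫ w, (e * g w ^ 2 + 1 / (4 * e)) ∂armLaw p := by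
        refine integral_mono hgi ((hg2i.const_mul _).add (integrable_const _)) fun w => ?_
        have h1 : (0 : ℝ) ≤ (2 * e * |g w| - 1) ^ 2 / (4 * e) := by positivity
        have h2 : (2 * e * |g w| - 1) ^ 2 / (4 * e) = e * |g w| ^ 2 + 1 / (4 * e) - |g w| := by
          field_simp; ring
        rw [h2, sq_abs] at h1
        linarith
    _ = e * ∫ w, g w ^ 2 ∂armLaw p + 1 / (4 * e) := by
        rw [integral_add (hg2i.const_mul _) (integrable_const _), integral_const_mul]; simp
    _ ≤ e * (1 / (4 * e ^ 2)) + 1 / (4 * e) := by gcongr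
    _ = _ := by field_simp; norm_num

lemma integrable_armLaw_fst {p : Measure ℝ} [IsProbabilityMeasure p]
    (hp : ∀ᵐ x ∂p, x ∈ Set.Icc (0 : ℝ) 1) :
    Integrable (fun w : ℝ × (ℕ → unitInterval) => w.1) (armLaw p) :=
  Integrable.of_bound (by fun_prop) 1 ((ae_armLaw_fst hp).mono fun w hw => by
    rw [Real.norm_eq_abs, abs_of_nonneg hw.1]; exact hw.2)

/-- The empirical mean of the first `n` samples is at least `c`. -/
def LooksHigh (n : ℕ) (c : ℝ) (d : ℕ → Bool) : Prop := n * c ≤ successes n d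

/-- The empirical mean of the first `n` samples is at most `c`. -/
def LooksLow (n : ℕ) (c : ℝ) (d : ℕ → Bool) : Prop := successes n d ≤ n * c

lemma measurableSet_looksHigh (n : ℕ) (c : ℝ) : MeasurableSet {w | LooksHigh n c (armSample w)} :=
  measurableSet_le measurable_const (measurable_successes n)

lemma measurableSet_looksLow (n : ℕ) (c : ℝ) : MeasurableSet {w | LooksLow n c (armSample w)} :=
  measurableSet_le (measurable_successes n) measurable_const

/-- The indicator of the event that the arm looks high. -/
def highWeight (n : ℕ) (c : ℝ) (w : ℝ × (ℕ → unitInterval)) : ℝ :=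
  {w | LooksHigh n c (armSample w)}.indicator (fun _ => 1) w

/-- The indicator of the event that the arm looks low. -/
def lowWeight (n : ℕ) (c : ℝ) (w : ℝ × (ℕ → unitInterval)) : ℝ :=
  {w | LooksLow n c (armSample w)}.indicator (fun _ => 1) w

lemma measurable_highWeight (n : ℕ) (c : ℝ) : Measurable (highWeight n c) :=
  measurable_const.indicator (measurableSet_looksHigh n c)

lemma measurable_lowWeight (n : ℕ) (c : ℝ) : Measurable (lowWeight n c) :=
  measurable_const.indicator (measurableSet_looksLow n c)

lemma highWeight_mem (n : ℕ) (c : ℝ) (w : ℝ × (ℕ → unitInterval)) :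
    highWeight n c w ∈ Set.Icc (0 : ℝ) 1 := by
  unfold highWeight Set.indicator; split_ifs <;> simp

lemma lowWeight_mem (n : ℕ) (c : ℝ) (w : ℝ × (ℕ → unitInterval)) :
    lowWeight n c w ∈ Set.Icc (0 : ℝ) 1 := by
  unfold lowWeight Set.indicator; split_ifs <;> simp

lemma integrable_weight {p : Measure ℝ} [IsProbabilityMeasure p]
    {φ : ℝ × (ℕ → unitInterval) → ℝ} (hφ : Measurable φ) (h : ∀ w, φ w ∈ Set.Icc (0 : ℝ) 1) :
    Integrable φ (armLaw p) :=
  Integrable.of_bound hφ.aestronglyMeasurable 1 (Filter.Eventually.of_forall fun w => by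
    rw [Real.norm_eq_abs, abs_of_nonneg (h w).1]; exact (h w).2)

lemma integrable_weight_mul_fst {p : Measure ℝ} [IsProbabilityMeasure p]
    (hp : ∀ᵐ x ∂p, x ∈ Set.Icc (0 : ℝ) 1)
    {φ : ℝ × (ℕ → unitInterval) → ℝ} (hφ : Measurable φ) (h : ∀ w, φ w ∈ Set.Icc (0 : ℝ) 1) :
    Integrable (fun w => φ w * w.1) (armLaw p) :=
  Integrable.of_bound (hφ.mul measurable_fst).aestronglyMeasurable 1
    ((ae_armLaw_fst hp).mono fun w hw => by
      rw [Real.norm_eq_abs, abs_of_nonneg (mul_nonneg (h w).1 hw.1)]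
      exact mul_le_one₀ (h w).2 hw.1 hw.2)

lemma integrable_abs_successes_sub {p : Measure ℝ} [IsProbabilityMeasure p]
    (hp : ∀ᵐ x ∂p, x ∈ Set.Icc (0 : ℝ) 1) {e : ℕ} (he : 0 < e) :
    Integrable (fun w => |successes (e ^ 2) (armSample w) / e ^ 2 - w.1|) (armLaw p) := by
  have he' : (0 : ℝ) < e := by exact_mod_cast he
  refine Integrable.of_bound
    (((measurable_successes _).div_const _).sub measurable_fst).abs.aestronglyMeasurable 1 ?_
  filter_upwards [ae_armLaw_fst hp] with w hw
  have h1 : successes (e ^ 2) (armSample w) / e ^ 2 ≤ 1 := by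
    rw [div_le_one (by positivity)]
    exact_mod_cast successes_le (e ^ 2) (armSample w)
  have h2 : 0 ≤ successes (e ^ 2) (armSample w) / e ^ 2 :=
    div_nonneg (successes_nonneg _ _) (by positivity)
  rw [Real.norm_eq_abs, abs_abs, abs_le]
  constructor <;> linarith [hw.1, hw.2]

/-- Selecting an arm when its empirical mean looks high is almost as good as knowing its mean. -/
lemma le_integral_highWeight {p : Measure ℝ} [IsProbabilityMeasure p]
    (hp : ∀ᵐ x ∂p, x ∈ Set.Icc (0 : ℝ) 1) {e : ℕ} (he : 0 < e) (c : ℝ) :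
    c * ∫ w, highWeight (e ^ 2) c w ∂armLaw p + (∫ x, max (x - c) 0 ∂p - 1 / (2 * e)) ≤
      ∫ w, highWeight (e ^ 2) c w * w.1 ∂armLaw p := by
  have he' : (0 : ℝ) < (e : ℝ) ^ 2 := by positivity
  have i1 := integrable_weight (p := p) (measurable_highWeight (e ^ 2) c) (highWeight_mem _ _)
  have i2 := integrable_weight_mul_fst hp (measurable_highWeight (e ^ 2) c) (highWeight_mem _ _)
  have i3 := integrable_abs_successes_sub hp he
  have i4 : Integrable (fun w : ℝ × (ℕ → unitInterval) => max (w.1 - c) 0) (armLaw p) :=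
    ((integrable_armLaw_fst hp).sub (integrable_const c)).pos_part
  rw [← integral_armLaw_fst p fun x => max (x - c) 0]
  -- If the empirical mean and the true mean lie on different sides of `c`, then the true mean is
  -- closer to `c` than to the empirical mean. So a wrong decision costs at most the estimation
  -- error.
  have key : ∫ w, max (w.1 - c) 0 ∂armLaw p ≤ ∫ w, ((highWeight (e ^ 2) c w * w.1 -
      c * highWeight (e ^ 2) c w) + |successes (e ^ 2) (armSample w) / e ^ 2 - w.1|) ∂armLaw p := by
    refine integral_mono i4 ((i2.sub (i1.const_mul c)).add i3) fun w => ?_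
    by_cases h : LooksHigh (e ^ 2) c (armSample w)
    · have h' : c ≤ successes (e ^ 2) (armSample w) / e ^ 2 := by
        rw [le_div_iff₀ he']; unfold LooksHigh at h; push_cast at h; linarith
      simp only [highWeight, Set.indicator, Set.mem_ofPred_eq, h, if_true]
      have := le_abs_self (successes (e ^ 2) (armSample w) / e ^ 2 - w.1)
      exact max_le (by linarith [abs_nonneg (successes (e ^ 2) (armSample w) / e ^ 2 - w.1)])
        (by linarith)
    · have h' : successes (e ^ 2) (armSample w) / e ^ 2 < c := by
        rw [div_lt_iff₀ he']; unfold LooksHigh at h; push_cast at h; linarith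
      simp only [highWeight, Set.indicator, Set.mem_ofPred_eq, h, if_false]
      have := neg_abs_le (successes (e ^ 2) (armSample w) / e ^ 2 - w.1)
      exact max_le (by linarith) (by linarith [abs_nonneg (successes (e ^ 2) (armSample w) / e ^ 2 - w.1)])
  have i5 : Integrable (fun w => highWeight (e ^ 2) c w * w.1 - c * highWeight (e ^ 2) c w)
      (armLaw p) := i2.sub (i1.const_mul c)
  rw [integral_add i5 i3, integral_sub i2 (i1.const_mul c),
    integral_const_mul] at key
  linarith [integral_abs_successes_sub_le hp he]

/-- Selecting an arm when its empirical mean looks low is almost as good as knowing its mean. -/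
lemma integral_lowWeight_le {p : Measure ℝ} [IsProbabilityMeasure p]
    (hp : ∀ᵐ x ∂p, x ∈ Set.Icc (0 : ℝ) 1) {e : ℕ} (he : 0 < e) (c : ℝ) :
    ∫ w, lowWeight (e ^ 2) c w * w.1 ∂armLaw p + (∫ x, max (c - x) 0 ∂p - 1 / (2 * e)) ≤
      c * ∫ w, lowWeight (e ^ 2) c w ∂armLaw p := by
  have he' : (0 : ℝ) < (e : ℝ) ^ 2 := by positivity
  have i1 := integrable_weight (p := p) (measurable_lowWeight (e ^ 2) c) (lowWeight_mem _ _)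
  have i2 := integrable_weight_mul_fst hp (measurable_lowWeight (e ^ 2) c) (lowWeight_mem _ _)
  have i3 := integrable_abs_successes_sub hp he
  have i4 : Integrable (fun w : ℝ × (ℕ → unitInterval) => max (c - w.1) 0) (armLaw p) :=
    ((integrable_const c).sub (integrable_armLaw_fst hp)).pos_part
  rw [← integral_armLaw_fst p fun x => max (c - x) 0]
  have key : ∫ w, max (c - w.1) 0 ∂armLaw p ≤ ∫ w, ((c * lowWeight (e ^ 2) c w -
      lowWeight (e ^ 2) c w * w.1) + |successes (e ^ 2) (armSample w) / e ^ 2 - w.1|) ∂armLaw p := by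
    refine integral_mono i4 (((i1.const_mul c).sub i2).add i3) fun w => ?_
    by_cases h : LooksLow (e ^ 2) c (armSample w)
    · have h' : successes (e ^ 2) (armSample w) / e ^ 2 ≤ c := by
        rw [div_le_iff₀ he']; unfold LooksLow at h; push_cast at h; linarith
      simp only [lowWeight, Set.indicator, Set.mem_ofPred_eq, h, if_true]
      have := neg_abs_le (successes (e ^ 2) (armSample w) / e ^ 2 - w.1)
      exact max_le (by linarith [abs_nonneg (successes (e ^ 2) (armSample w) / e ^ 2 - w.1)])
        (by linarith)
    · have h' : c < successes (e ^ 2) (armSample w) / e ^ 2 := by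
        rw [lt_div_iff₀ he']; unfold LooksLow at h; push_cast at h; linarith
      simp only [lowWeight, Set.indicator, Set.mem_ofPred_eq, h, if_false]
      have := le_abs_self (successes (e ^ 2) (armSample w) / e ^ 2 - w.1)
      exact max_le (by linarith) (by linarith [abs_nonneg (successes (e ^ 2) (armSample w) / e ^ 2 - w.1)])
  have i5 : Integrable (fun w => c * lowWeight (e ^ 2) c w - lowWeight (e ^ 2) c w * w.1)
      (armLaw p) := (i1.const_mul c).sub i2
  rw [integral_add i5 i3, integral_sub (i1.const_mul c) i2,
    integral_const_mul] at key
  linarith [integral_abs_successes_sub_le hp he]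

/-! ### The expected gain from exploring an arm -/

/-- The indicator that an arm looks low, for the arms in `S`, and `1` for the others. -/
def screenWeight {K : ℕ} (S : Set (Fin K)) (n : ℕ) (c : ℝ) (i : Fin K) :
    ℝ × (ℕ → unitInterval) → ℝ :=
  S.indicator (fun _ => lowWeight n c) i + Sᶜ.indicator (fun _ _ => 1) i

lemma screenWeight_of_mem {K : ℕ} {S : Set (Fin K)} {n : ℕ} {c : ℝ} {i : Fin K} (h : i ∈ S) :
    screenWeight S n c i = lowWeight n c := by
  simp [screenWeight, h]

lemma screenWeight_of_notMem {K : ℕ} {S : Set (Fin K)} {n : ℕ} {c : ℝ} {i : Fin K} (h : i ∉ S) :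
    screenWeight S n c i = fun _ => 1 := by
  simp [screenWeight, h]

lemma measurable_screenWeight {K : ℕ} (S : Set (Fin K)) (n : ℕ) (c : ℝ) (i : Fin K) :
    Measurable (screenWeight S n c i) := by
  by_cases h : i ∈ S
  · rw [screenWeight_of_mem h]; exact measurable_lowWeight n c
  · rw [screenWeight_of_notMem h]; exact measurable_const

lemma screenWeight_mem {K : ℕ} (S : Set (Fin K)) (n : ℕ) (c : ℝ) (i : Fin K)
    (w : ℝ × (ℕ → unitInterval)) : screenWeight S n c i w ∈ Set.Icc (0 : ℝ) 1 := by
  by_cases h : i ∈ S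
  · rw [screenWeight_of_mem h]; exact lowWeight_mem n c w
  · rw [screenWeight_of_notMem h]; simp

/-- The event that all arms in `S` look low. -/
def allLow {K : ℕ} (S : Set (Fin K)) (n : ℕ) (c : ℝ) : Set (Env K) :=
  {e | ∀ i ∈ S, LooksLow n c (sample e i)}

/-- The event that arm `j` looks high. -/
def armHigh {K : ℕ} (j : Fin K) (n : ℕ) (c : ℝ) : Set (Env K) :=
  {e | LooksHigh n c (sample e j)}

lemma measurable_armData {K : ℕ} (i : Fin K) : Measurable fun e : Env K => armData e i := by
  unfold armData; fun_prop

lemma measurableSet_armHigh {K : ℕ} (j : Fin K) (n : ℕ) (c : ℝ) :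
    MeasurableSet (armHigh j n c) :=
  measurable_armData j (measurableSet_looksHigh n c)

lemma measurableSet_allLow {K : ℕ} (S : Set (Fin K)) (n : ℕ) (c : ℝ) :
    MeasurableSet (allLow S n c) := by
  have : allLow S n c = ⋂ i ∈ S, (fun e => armData e i) ⁻¹' {w | LooksLow n c (armSample w)} := by
    ext e; simp [allLow, sample_eq_armSample]
  rw [this]
  exact MeasurableSet.biInter S.to_countable fun i _ => measurable_armData i (measurableSet_looksLow n c)

lemma prod_screenWeight {K : ℕ} (S : Set (Fin K)) (n : ℕ) (c : ℝ) (e : Env K) :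
    ∏ i, screenWeight S n c i (armData e i) = (allLow S n c).indicator (fun _ => 1) e := by
  by_cases h : e ∈ allLow S n c
  · rw [Set.indicator_of_mem h]
    refine Finset.prod_eq_one fun i _ => ?_
    by_cases hi : i ∈ S
    · rw [screenWeight_of_mem hi, lowWeight, Set.indicator_of_mem]
      exact h i hi
    · rw [screenWeight_of_notMem hi]
  · rw [Set.indicator_of_notMem h]
    obtain ⟨i, hi, hlow⟩ : ∃ i ∈ S, ¬ LooksLow n c (sample e i) := by
      simpa [allLow] using h
    refine Finset.prod_eq_zero (Finset.mem_univ i) ?_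
    rw [screenWeight_of_mem hi, lowWeight, Set.indicator_of_notMem]
    exact hlow

lemma integrable_mul_reward_sub {K : ℕ} {P : Fin K → Measure ℝ} [∀ i, IsProbabilityMeasure (P i)]
    (hP : ∀ i, ∀ᵐ x ∂P i, x ∈ Set.Icc (0 : ℝ) 1) (j k : Fin K) :
    Integrable (fun e : Env K => e.1 j - e.1 k) (envLaw P) :=
  Integrable.of_bound (by fun_prop) 1 ((ae_envLaw_fst hP).mono fun e he => by
    rw [Real.norm_eq_abs, abs_le]
    constructor <;> linarith [(he j).1, (he j).2, (he k).1, (he k).2])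

/-! ### Gains on screening events, for priors with gap `1 / a` -/

section Gap

variable {K : ℕ} {P : Fin K → Measure ℝ} {a : ℕ}

lemma HasGap.integral_lowWeight_le (h : HasGap P (1 / a)) (ha : 0 < a) (i j : Fin K) :
    ∫ w, lowWeight (a ^ 2) (priorMean (P j)) w * w.1 ∂armLaw (P i) + 1 / (2 * a) ≤
      priorMean (P j) * ∫ w, lowWeight (a ^ 2) (priorMean (P j)) w ∂armLaw (P i) := by
  have := h.isProbabilityMeasure i
  have h1 := IncentivizedExploration.integral_lowWeight_le (h.mem_Icc i) ha (priorMean (P j))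
  have h2 := h.le_negPart i j
  have h3 : (1 : ℝ) / a = 1 / (2 * a) + 1 / (2 * a) := by field_simp; norm_num
  linarith

lemma HasGap.le_integral_highWeight (h : HasGap P (1 / a)) (ha : 0 < a) (i j : Fin K) :
    priorMean (P j) * ∫ w, highWeight (a ^ 2) (priorMean (P j)) w ∂armLaw (P i) + 1 / (2 * a) ≤
      ∫ w, highWeight (a ^ 2) (priorMean (P j)) w * w.1 ∂armLaw (P i) := by
  have := h.isProbabilityMeasure i
  have h1 := IncentivizedExploration.le_integral_highWeight (h.mem_Icc i) ha (priorMean (P j))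
  have h2 := h.le_posPart i j
  have h3 : (1 : ℝ) / a = 1 / (2 * a) + 1 / (2 * a) := by field_simp; norm_num
  linarith

/-- The event of looking low carries a gain of `1 / (2a)` with rewards in `[0, 1]`, so its
probability cannot be smaller than that gain. -/
lemma HasGap.le_integral_screenWeight (h : HasGap P (1 / a)) (ha : 0 < a) (S : Set (Fin K))
    (i j : Fin K) :
    1 / (2 * a) ≤ ∫ w, screenWeight S (a ^ 2) (priorMean (P j)) i w ∂armLaw (P i) := by
  have := h.isProbabilityMeasure i
  have ha1 : (1 : ℝ) ≤ a := by exact_mod_cast ha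
  by_cases hi : i ∈ S
  · rw [screenWeight_of_mem hi]
    have h1 := h.integral_lowWeight_le ha i j
    have h2 : 0 ≤ ∫ w, lowWeight (a ^ 2) (priorMean (P j)) w ∂armLaw (P i) :=
      integral_nonneg fun w => (lowWeight_mem _ _ w).1
    have h3 : 0 ≤ ∫ w, lowWeight (a ^ 2) (priorMean (P j)) w * w.1 ∂armLaw (P i) :=
      integral_nonneg_of_ae ((ae_armLaw_fst (h.mem_Icc i)).mono fun w hw =>
        mul_nonneg (lowWeight_mem _ _ w).1 hw.1)
    nlinarith [(h.priorMean_mem j).2]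
  · rw [screenWeight_of_notMem hi]
    simp only [integral_const, probReal_univ, smul_eq_mul, mul_one]
    rw [div_le_one (by positivity)]; linarith

/-- A screened arm does not have a larger mean reward than `c`. -/
lemma HasGap.integral_screenWeight_le (h : HasGap P (1 / a)) (ha : 0 < a) {S : Set (Fin K)}
    {i j : Fin K} {c : ℝ} (hj : priorMean (P j) ≤ c) (hi : i ∉ S → priorMean (P i) ≤ c) :
    ∫ w, screenWeight S (a ^ 2) (priorMean (P j)) i w * w.1 ∂armLaw (P i) ≤
      c * ∫ w, screenWeight S (a ^ 2) (priorMean (P j)) i w ∂armLaw (P i) := by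
  have := h.isProbabilityMeasure i
  by_cases hiS : i ∈ S
  · rw [screenWeight_of_mem hiS]
    have h1 := h.integral_lowWeight_le ha i j
    have h2 : 0 ≤ ∫ w, lowWeight (a ^ 2) (priorMean (P j)) w ∂armLaw (P i) :=
      integral_nonneg fun w => (lowWeight_mem _ _ w).1
    have h3 : (0 : ℝ) ≤ 1 / (2 * a) := by positivity
    nlinarith
  · rw [screenWeight_of_notMem hiS]
    have : ∫ w, w.1 ∂armLaw (P i) = priorMean (P i) := integral_armLaw_fst (P i) fun x => x
    simpa [this] using hi hiS

/-- Exploring an arm when all preceding arms look low. -/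
lemma HasGap.integral_allLow_nonneg (h : HasGap P (1 / a)) (ha : 0 < a) {S : Set (Fin K)}
    {j : Fin K} (hjS : j ∉ S) (hS : ∀ i ∉ S, priorMean (P i) ≤ priorMean (P j)) (k : Fin K) :
    0 ≤ ∫ e in allLow S (a ^ 2) (priorMean (P j)), (e.1 j - e.1 k) ∂envLaw P := by
  have := h.isProbabilityMeasure
  rcases eq_or_ne j k with rfl | hjk
  · simp
  -- The reference value `c` is the prior mean of `j`: arm `j` itself is not screened and meets it
  -- exactly, while every other arm is either screened against it or has a smaller prior mean.
  have h1 := le_integral_prod_mul_sub h.mem_Icc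
    (φ := screenWeight S (a ^ 2) (priorMean (P j))) (fun i => measurable_screenWeight _ _ _ i)
    (fun i w => (screenWeight_mem _ _ _ i w).1) (fun i w => (screenWeight_mem _ _ _ i w).2) hjk
    (c := priorMean (P j)) (γ := 0) (h.integral_screenWeight_le ha le_rfl (hS k)) (by
      rw [screenWeight_of_notMem hjS]
      have : ∫ w, w.1 ∂armLaw (P j) = priorMean (P j) := integral_armLaw_fst (P j) fun x => x
      simp [this])
  simp_rw [prod_screenWeight] at h1
  rw [← integral_indicator (measurableSet_allLow _ _ _)]
  simpa [Set.indicator] using h1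

/-- The gain from choosing an arm that looks high, when all preceding arms look low. -/
lemma HasGap.le_integral_allLow_inter_armHigh (h : HasGap P (1 / a)) (ha : 0 < a)
    {S : Set (Fin K)} {j k m : Fin K} (hjS : j ∉ S) (hm : ∀ i, priorMean (P i) ≤ priorMean (P m))
    (hjk : j ≠ k) :
    1 / (2 * a) * ∏ i ∈ Finset.univ \ {j},
      ∫ w, screenWeight S (a ^ 2) (priorMean (P j)) i w ∂armLaw (P i) ≤
      ∫ e in allLow S (a ^ 2) (priorMean (P j)) ∩ armHigh j (a ^ 2) (priorMean (P m)),
        (e.1 j - e.1 k) ∂envLaw P := by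
  have := h.isProbabilityMeasure
  set φ := Function.update (screenWeight S (a ^ 2) (priorMean (P j))) j
    (highWeight (a ^ 2) (priorMean (P m))) with hφ
  have hφj : φ j = highWeight (a ^ 2) (priorMean (P m)) := by simp [hφ]
  have hφi : ∀ i, i ≠ j → φ i = screenWeight S (a ^ 2) (priorMean (P j)) i := fun i hi => by
    simp [hφ, hi]
  have hmem : ∀ i w, φ i w ∈ Set.Icc (0 : ℝ) 1 := by
    intro i w
    rcases eq_or_ne i j with rfl | hi
    · rw [hφj]; exact highWeight_mem _ _ w
    · rw [hφi i hi]; exact screenWeight_mem _ _ _ i w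
  -- Now `c` is the largest prior mean. Arm `j` beats it by `1 / (2a)` when it looks high, and no
  -- other arm, screened or not, beats it on average.
  have h1 := le_integral_prod_mul_sub h.mem_Icc (φ := φ) (fun i => by
      rcases eq_or_ne i j with rfl | hi
      · rw [hφj]; exact measurable_highWeight _ _
      · rw [hφi i hi]; exact measurable_screenWeight _ _ _ i)
    (fun i w => (hmem i w).1) (fun i w => (hmem i w).2) hjk
    (c := priorMean (P m)) (γ := 1 / (2 * a)) (by
      rw [hφi k hjk.symm]
      exact h.integral_screenWeight_le ha (hm j) fun _ => hm k) (by
      rw [hφj]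
      exact h.le_integral_highWeight ha j m)
  have h2 : ∀ e : Env K, ∏ i, φ i (armData e i) =
      (allLow S (a ^ 2) (priorMean (P j)) ∩ armHigh j (a ^ 2) (priorMean (P m))).indicator
        (fun _ => 1) e := by
    intro e
    have h3 : ∏ i, φ i (armData e i) = highWeight (a ^ 2) (priorMean (P m)) (armData e j) *
        ∏ i, screenWeight S (a ^ 2) (priorMean (P j)) i (armData e i) := by
      have p1 := Finset.mul_prod_erase Finset.univ (fun i => φ i (armData e i)) (Finset.mem_univ j)
      have p2 := Finset.mul_prod_erase Finset.univ
        (fun i => screenWeight S (a ^ 2) (priorMean (P j)) i (armData e i)) (Finset.mem_univ j)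
      rw [← p1, ← p2, hφj, screenWeight_of_notMem hjS, one_mul]
      congr 1
      exact Finset.prod_congr rfl fun i hi => by rw [hφi i (Finset.ne_of_mem_erase hi)]
    rw [h3, prod_screenWeight, highWeight]
    by_cases hA : e ∈ allLow S (a ^ 2) (priorMean (P j)) <;>
    by_cases hB : e ∈ armHigh j (a ^ 2) (priorMean (P m)) <;>
    · have hB' := hB
      simp only [armHigh, sample_eq_armSample, Set.mem_ofPred_eq] at hB'
      simp [Set.indicator, hA, hB, hB']
  simp_rw [h2] at h1
  rw [← integral_indicator ((measurableSet_allLow _ _ _).inter (measurableSet_armHigh _ _ _))]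
  have h4 : ∏ i ∈ Finset.univ \ {j}, ∫ w, φ i w ∂armLaw (P i) = ∏ i ∈ Finset.univ \ {j},
      ∫ w, screenWeight S (a ^ 2) (priorMean (P j)) i w ∂armLaw (P i) :=
    Finset.prod_congr rfl fun i hi => by rw [hφi i (by simpa using hi)]
  rw [h4] at h1
  refine h1.trans (le_of_eq ?_)
  congr with e
  simp [Set.indicator]

/-- Source of the term `z = (1 / (2a))^K` in `phaseLevel`. There are at most `K` factors, each at
least `1 / (2a) ≤ 1`. -/
lemma HasGap.pow_le_prod_screenWeight (h : HasGap P (1 / a)) (ha : 0 < a) (S : Set (Fin K))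
    (j : Fin K) :
    (1 / (2 * a) : ℝ) ^ K ≤ ∏ i ∈ Finset.univ \ {j},
      ∫ w, screenWeight S (a ^ 2) (priorMean (P j)) i w ∂armLaw (P i) := by
  have ha1 : (1 : ℝ) ≤ a := by exact_mod_cast ha
  have h1 : (1 / (2 * a) : ℝ) ≤ 1 := by rw [div_le_one (by positivity)]; linarith
  calc (1 / (2 * a) : ℝ) ^ K ≤ (1 / (2 * a) : ℝ) ^ (Finset.univ \ {j} : Finset (Fin K)).card :=
        pow_le_pow_of_le_one (by positivity) h1 ((Finset.card_le_univ _).trans (by simp))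
    _ = ∏ i ∈ (Finset.univ \ {j} : Finset (Fin K)), (1 / (2 * a) : ℝ) := by simp
    _ ≤ _ := Finset.prod_le_prod (fun _ _ => by positivity) fun i _ =>
        h.le_integral_screenWeight ha S i j

/-- The case of no screened arms, where the product of the other weights is `1`. -/
lemma HasGap.le_integral_armHigh (h : HasGap P (1 / a)) (ha : 0 < a)
    {j k m : Fin K} (hm : ∀ i, priorMean (P i) ≤ priorMean (P m)) (hjk : j ≠ k) :
    1 / (2 * a) ≤ ∫ e in armHigh j (a ^ 2) (priorMean (P m)), (e.1 j - e.1 k) ∂envLaw P := by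
  have := h.isProbabilityMeasure
  have h1 := h.le_integral_allLow_inter_armHigh ha (Set.notMem_empty j) hm hjk
  have h2 : allLow (∅ : Set (Fin K)) (a ^ 2) (priorMean (P j)) = Set.univ := by ext; simp [allLow]
  rw [h2, Set.univ_inter] at h1
  simpa [screenWeight_of_notMem] using h1

end Gap

/-! ### Randomized events -/

lemma volume_real_unitInterval_le {a : ℝ} (ha : a ∈ Set.Icc (0 : ℝ) 1) :
    (volume : Measure unitInterval).real {u | (u : ℝ) ≤ a} = a := by
  have : {u : unitInterval | (u : ℝ) ≤ a} = Set.Iic ⟨a, ha⟩ := by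
    ext u; simp [← Subtype.coe_le_coe]
  rw [this, Measure.real, unitInterval.volume_Iic]
  simp [ha.1]

/-- Integrating over the union of an event with an independent one. -/
lemma setIntegral_union_randomized {K : ℕ} {P : Fin K → Measure ℝ}
    [∀ i, IsProbabilityMeasure (P i)] {Z A : Set (Env K)} (hZ : MeasurableSet Z)
    (hA : MeasurableSet A) {f : Env K → ℝ} (hf : Integrable f (envLaw P)) {a : ℝ}
    (ha : a ∈ Set.Icc (0 : ℝ) 1) :
    ∫ x in {x : unitInterval × Env K | (x.2 ∈ Z ∨ (x.1 : ℝ) ≤ a) ∧ x.2 ∈ A}, f x.2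
        ∂((volume : Measure unitInterval).prod (envLaw P)) =
      a * ∫ e in A, f e ∂envLaw P + (1 - a) * ∫ e in Z ∩ A, f e ∂envLaw P := by
  have hU : MeasurableSet {u : unitInterval | (u : ℝ) ≤ a} :=
    measurableSet_le (by fun_prop) (by fun_prop)
  have hS : MeasurableSet {x : unitInterval × Env K | (x.2 ∈ Z ∨ (x.1 : ℝ) ≤ a) ∧ x.2 ∈ A} :=
    ((measurable_snd hZ).union (measurable_fst hU)).inter (measurable_snd hA)
  have hind : Integrable ({u : unitInterval | (u : ℝ) ≤ a}.indicator fun _ => (1 : ℝ)) :=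
    (integrable_const 1).indicator hU
  -- For seeds at most `a` the event is `A`, for the others it is `Z ∩ A`. This writes the integrand
  -- as a sum of products of a function of the seed and a function of the environment.
  have h1 : ∀ x : unitInterval × Env K,
      {x : unitInterval × Env K | (x.2 ∈ Z ∨ (x.1 : ℝ) ≤ a) ∧ x.2 ∈ A}.indicator
        (fun x => f x.2) x =
      {u : unitInterval | (u : ℝ) ≤ a}.indicator (fun _ => (1 : ℝ)) x.1 * A.indicator f x.2 +
      (1 - {u : unitInterval | (u : ℝ) ≤ a}.indicator (fun _ => (1 : ℝ)) x.1) *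
        (Z ∩ A).indicator f x.2 := by
    intro x
    by_cases hz : x.2 ∈ Z <;> by_cases hA : x.2 ∈ A <;> by_cases hu : (x.1 : ℝ) ≤ a <;>
      simp [Set.indicator, hz, hA, hu]
  rw [← integral_indicator hS]
  simp_rw [h1]
  have hi1 : Integrable (fun u : unitInterval =>
      1 - {u : unitInterval | (u : ℝ) ≤ a}.indicator (fun _ => (1 : ℝ)) u) :=
    (integrable_const 1).sub hind
  rw [integral_add (hind.mul_prod (hf.indicator hA)) (hi1.mul_prod (hf.indicator (hZ.inter hA))),
    integral_prod_mul, integral_prod_mul (fun u : unitInterval =>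
      1 - {u : unitInterval | (u : ℝ) ≤ a}.indicator (fun _ => (1 : ℝ)) u),
    integral_sub (integrable_const 1) hind, integral_indicator hA, integral_indicator (hZ.inter hA)]
  have h2 : ∫ u : unitInterval, {u : unitInterval | (u : ℝ) ≤ a}.indicator (fun _ => (1 : ℝ)) u = a :=
    (integral_indicator_one hU).trans (volume_real_unitInterval_le ha)
  rw [h2]; simp

/-! ### Exponential growth of the exploration probability -/

/-- The probability that an arm has been explored by phase `l` regardless of its predecessors,
which grows exponentially in `l`. -/
def level (h z : ℝ) : ℕ → ℝ
  | 0 => 0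
  | l + 1 => min 1 (level h z l + h * (level h z l + z))

lemma level_mem {h z : ℝ} (hh : 0 ≤ h) (hz : 0 ≤ z) (l : ℕ) : level h z l ∈ Set.Icc (0 : ℝ) 1 := by
  induction l with
  | zero => simp [level]
  | succ l ih =>
    have := ih.1
    exact ⟨le_min zero_le_one (by positivity), min_le_left _ _⟩

lemma level_le_succ {h z : ℝ} (hh : 0 ≤ h) (hz : 0 ≤ z) (l : ℕ) :
    level h z l ≤ level h z (l + 1) := by
  have := level_mem hh hz l
  have h1 := this.1
  exact le_min this.2 (le_add_of_nonneg_right (by positivity))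

lemma level_succ_sub_le (h z : ℝ) (l : ℕ) :
    level h z (l + 1) - level h z l ≤ h * (level h z l + z) := by
  linarith [min_le_right 1 (level h z l + h * (level h z l + z)),
    show level h z (l + 1) = min 1 (level h z l + h * (level h z l + z)) from rfl]

/-- Until the cap at `1` is reached, `level + z` is multiplied by `1 + h` in each step. -/
lemma le_level {h z : ℝ} (hh : 0 ≤ h) (hz : 0 ≤ z) (l : ℕ) :
    min 1 (z * ((1 + h) ^ l - 1)) ≤ level h z l := by
  induction l with
  | zero => simp [level]
  | succ l ih =>
    refine le_min (min_le_left _ _) ?_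
    have h0 := level_mem hh hz l
    rcases min_le_iff.1 ih with h1 | h1
    · refine (min_le_left _ _).trans (h1.trans (le_add_of_nonneg_right ?_))
      have := h0.1
      positivity
    · refine (min_le_right _ _).trans ?_
      calc z * ((1 + h) ^ (l + 1) - 1) = (1 + h) * (z * ((1 + h) ^ l - 1)) + h * z := by ring
        _ ≤ (1 + h) * level h z l + h * z := by gcongr
        _ = _ := by ring

/-- The number of phases after which an arm has been explored for sure. -/
def phases (K a : ℕ) : ℕ := 4 * a * (2 * a * K + 1)

/-- Every `4a` phases multiply `level + z` by at least `2` (Bernoulli), and `2aK + 1` doublings give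
a factor of at least `2 (2a)^K`, as `2a ≤ 2^{2a}`. Then `z ((1 + h)^l - 1) ≥ 2 - z ≥ 1`. -/
lemma level_phases {K a : ℕ} (ha : 0 < a) :
    level (1 / (4 * a)) ((1 / (2 * a)) ^ K) (phases K a) = 1 := by
  have ha' : (0 : ℝ) < a := by exact_mod_cast ha
  have hz : (0 : ℝ) < (1 / (2 * a)) ^ K := by positivity
  refine le_antisymm (level_mem (by positivity) hz.le _).2 ?_
  refine le_trans (le_min le_rfl ?_) (le_level (by positivity) hz.le _)
  have h1 : (2 : ℝ) ≤ (1 + 1 / (4 * a)) ^ (4 * a) := by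
    have := one_add_mul_le_pow (a := (1 / (4 * a) : ℝ))
      (by linarith [show (0 : ℝ) ≤ 1 / (4 * a) by positivity]) (4 * a)
    have h2 : ((4 * a : ℕ) : ℝ) * (1 / (4 * a)) = 1 := by push_cast; field_simp
    linarith
  have h3 : (2 * a : ℝ) ≤ 2 ^ (2 * a) := by
    have : 2 * a < 2 ^ (2 * a) := Nat.lt_two_pow_self
    exact_mod_cast this.le
  have h4 : 2 * (2 * a : ℝ) ^ K ≤ (1 + 1 / (4 * a)) ^ phases K a := by
    calc 2 * (2 * a : ℝ) ^ K ≤ 2 * (2 ^ (2 * a)) ^ K := by gcongr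
      _ = 2 ^ (2 * a * K + 1) := by ring
      _ ≤ ((1 + 1 / (4 * a)) ^ (4 * a)) ^ (2 * a * K + 1) := by gcongr
      _ = _ := by rw [← pow_mul, phases]
  have h5 : ((1 / (2 * a)) ^ K : ℝ) ≤ 1 := by
    refine pow_le_one₀ (by positivity) ?_
    rw [div_le_one (by positivity)]
    have : (1 : ℝ) ≤ a := by exact_mod_cast ha
    linarith
  have h6 : ((1 / (2 * a)) ^ K : ℝ) * (2 * (2 * a : ℝ) ^ K) = 2 := by
    rw [one_div, inv_pow]; field_simp
  calc (1 : ℝ) ≤ 2 - (1 / (2 * a)) ^ K := by linarith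
    _ = (1 / (2 * a)) ^ K * (2 * (2 * a : ℝ) ^ K - 1) := by rw [mul_sub, h6]; ring
    _ ≤ _ := by gcongr

/-! ### The exploration events -/

lemma measurableSet_unitInterval_le (c : ℝ) : MeasurableSet {u : unitInterval | (u : ℝ) ≤ c} :=
  measurableSet_le (by fun_prop) (by fun_prop)

section Explore

variable {K : ℕ} (P : Fin K → Measure ℝ) (a : ℕ)

/-- The arms in the order of decreasing prior mean rewards. -/
def armOrder : Equiv.Perm (Fin K) := Tuple.sort fun i => -priorMean (P i)

lemma priorMean_armOrder_le {r r' : Fin K} (h : r ≤ r') :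
    priorMean (P (armOrder P r')) ≤ priorMean (P (armOrder P r)) :=
  neg_le_neg_iff.1 (Tuple.monotone_sort (fun i => -priorMean (P i)) h)

/-- The arms of rank less than `r`. -/
def earlier (r : Fin K) : Set (Fin K) := {i | (armOrder P).symm i < r}

lemma armOrder_notMem_earlier (r : Fin K) : armOrder P r ∉ earlier P r := by simp [earlier]

lemma priorMean_le_of_notMem_earlier {r i : Fin K} (h : i ∉ earlier P r) :
    priorMean (P i) ≤ priorMean (P (armOrder P r)) := by
  have := priorMean_armOrder_le P (not_lt.1 h)
  rwa [Equiv.apply_symm_apply] at this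

/-- The largest prior mean reward. -/
def topMean : ℝ := ⨆ i, priorMean (P i)

/-- The probability levels of the phases. -/
def phaseLevel (l : ℕ) : ℝ := level (1 / (4 * a)) ((1 / (2 * a)) ^ K) l

/-- The event, in terms of the seed `u` and the samples `d` of the arms, that the arm of rank `r`
is explored in one of the phases `0, ..., l`. -/
def Ready (r : Fin K) (l : ℕ) (u : unitInterval) (d : Fin K → ℕ → Bool) : Prop :=
  (∀ i ∈ earlier P r, LooksLow (a ^ 2) (priorMean (P (armOrder P r))) (d i)) ∨
    (u : ℝ) ≤ phaseLevel (K := K) a l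

/-- The event that the arm of rank `r` is recommended in its phase `l`: either it is explored in
this phase, or it was explored in an earlier one and looks high. -/
def Explore (r : Fin K) : ℕ → unitInterval → (Fin K → ℕ → Bool) → Prop
  | 0, u, d => Ready P a r 0 u d
  | l + 1, u, d => (Ready P a r l u d ∧ LooksHigh (a ^ 2) (topMean P) (d (armOrder P r))) ∨
      (Ready P a r (l + 1) u d ∧ ¬ Ready P a r l u d)

/-- The event that the arm of rank `r` is recommended in its phase `l`. -/
def exploreSet (r : Fin K) (l : ℕ) : Set (unitInterval × Env K) :=
  {x | Explore P a r l x.1 (sample x.2)}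

/-- The event that the arm of rank `r` is explored in one of the phases `0, ..., l`. -/
def readySet (r : Fin K) (l : ℕ) : Set (unitInterval × Env K) :=
  {x | Ready P a r l x.1 (sample x.2)}

lemma readySet_eq (r : Fin K) (l : ℕ) : readySet P a r l =
    {x | x.2 ∈ allLow (earlier P r) (a ^ 2) (priorMean (P (armOrder P r))) ∨
      (x.1 : ℝ) ≤ phaseLevel (K := K) a l} := rfl

lemma measurableSet_readySet (r : Fin K) (l : ℕ) : MeasurableSet (readySet P a r l) :=
  (measurable_snd (measurableSet_allLow _ _ _)).union
    (measurable_fst (measurableSet_unitInterval_le _))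

lemma exploreSet_succ (r : Fin K) (l : ℕ) : exploreSet P a r (l + 1) =
    readySet P a r l ∩ Prod.snd ⁻¹' armHigh (armOrder P r) (a ^ 2) (topMean P) ∪
      readySet P a r (l + 1) \ readySet P a r l := rfl

lemma measurableSet_exploreSet (r : Fin K) (l : ℕ) : MeasurableSet (exploreSet P a r l) := by
  cases l with
  | zero => exact measurableSet_readySet P a r 0
  | succ l =>
    rw [exploreSet_succ]
    exact ((measurableSet_readySet P a r l).inter
      (measurable_snd (measurableSet_armHigh _ _ _))).union
      ((measurableSet_readySet P a r (l + 1)).diff (measurableSet_readySet P a r l))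

variable {P a}

lemma phaseLevel_mem (l : ℕ) : phaseLevel (K := K) a l ∈ Set.Icc (0 : ℝ) 1 :=
  level_mem (by positivity) (by positivity) l

lemma phaseLevel_phases (ha : 0 < a) : phaseLevel (K := K) a (phases K a) = 1 := level_phases ha

lemma integrable_reward_sub (hP : ∀ i, IsProbabilityMeasure (P i))
    (hP' : ∀ i, ∀ᵐ x ∂P i, x ∈ Set.Icc (0 : ℝ) 1) (j k : Fin K) :
    Integrable (fun x : unitInterval × Env K => x.2.1 j - x.2.1 k)
      ((volume : Measure unitInterval).prod (envLaw P)) :=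
  (integrable_mul_reward_sub hP' j k).comp_snd _

/-- Whenever the arm of rank `r` is recommended on the exploration event, this is in the interest
of the agents. -/
theorem HasGap.integral_exploreSet_nonneg (h : HasGap P (1 / a)) (ha : 0 < a) (r : Fin K) (l : ℕ)
    (k : Fin K) :
    0 ≤ ∫ x in exploreSet P a r l, (x.2.1 (armOrder P r) - x.2.1 k)
      ∂((volume : Measure unitInterval).prod (envLaw P)) := by
  have hprob := h.isProbabilityMeasure
  set j := armOrder P r with hj
  rcases eq_or_ne j k with hjk | hjk
  · simp [← hjk]
  set Z := allLow (earlier P r) (a ^ 2) (priorMean (P j)) with hZ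
  have hZm : MeasurableSet Z := measurableSet_allLow _ _ _
  have hfi := integrable_mul_reward_sub h.mem_Icc j k
  have hFi := integrable_reward_sub h.isProbabilityMeasure h.mem_Icc j k
  have hZ0 := h.integral_allLow_nonneg ha (armOrder_notMem_earlier P r)
    (fun i hi => priorMean_le_of_notMem_earlier P hi) k
  cases l with
  | zero =>
    -- Level `0` is zero, so in the first phase the seed contributes nothing and only the screening
    -- event counts.
    have h1 := setIntegral_union_randomized (P := P) hZm MeasurableSet.univ hfi
      (phaseLevel_mem (K := K) (a := a) 0)
    have h2 : exploreSet P a r 0 = {x : unitInterval × Env K |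
        (x.2 ∈ Z ∨ (x.1 : ℝ) ≤ phaseLevel (K := K) a 0) ∧ x.2 ∈ Set.univ} := by
      ext x; simp [exploreSet, Explore, Ready, hZ, allLow, hj]
    rw [h2, h1, show phaseLevel (K := K) a 0 = 0 from rfl, Set.inter_univ]
    simpa using hZ0
  | succ l =>
    obtain ⟨m, hm⟩ : ∃ m : Fin K, priorMean (P m) = topMean P := by
      have : Nonempty (Fin K) := ⟨r⟩
      exact exists_eq_ciSup_of_finite (f := fun i => priorMean (P i))
    have hmax : ∀ i, priorMean (P i) ≤ priorMean (P m) := fun i => by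
      rw [hm]; exact le_ciSup (f := fun i => priorMean (P i)) (Set.finite_range _).bddAbove i
    set A := armHigh j (a ^ 2) (topMean P) with hA
    have hAm : MeasurableSet A := measurableSet_armHigh _ _ _
    set u := phaseLevel (K := K) a l with hu
    have hu01 : u ∈ Set.Icc (0 : ℝ) 1 := phaseLevel_mem l
    have ha1 : (1 : ℝ) ≤ a := by exact_mod_cast ha
    set z := ((1 / (2 * a)) ^ K : ℝ) with hz
    have hz0 : 0 ≤ z := by positivity
    have hz1 : z ≤ 1 := by
      refine pow_le_one₀ (by positivity) ?_
      rw [div_le_one (by positivity)]; linarith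
    have hhigh : 1 / (2 * a) ≤ ∫ e in A, (e.1 j - e.1 k) ∂envLaw P := by
      rw [hA, ← hm]; exact h.le_integral_armHigh ha hmax hjk
    have hboth : 1 / (2 * a) * z ≤ ∫ e in Z ∩ A, (e.1 j - e.1 k) ∂envLaw P := by
      rw [hA, ← hm]
      refine le_trans ?_
        (h.le_integral_allLow_inter_armHigh ha (armOrder_notMem_earlier P r) hmax hjk)
      gcongr
      exact h.pow_le_prod_screenWeight ha _ j
    have hmain := setIntegral_union_randomized (P := P) hZm hAm hfi hu01
    set B := readySet P a r (l + 1) \ readySet P a r l with hB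
    have hBm : MeasurableSet B :=
      (measurableSet_readySet P a r (l + 1)).diff (measurableSet_readySet P a r l)
    -- An arm becomes ready in this phase only if the screening event fails and the seed lies
    -- between the two levels. The loss there is at most `1` per unit of probability.
    have hdiff : -(phaseLevel (K := K) a (l + 1) - u) ≤ ∫ x in B, (x.2.1 j - x.2.1 k)
        ∂((volume : Measure unitInterval).prod (envLaw P)) := by
      have hBsub : B ⊆ {v : unitInterval | u < v ∧ (v : ℝ) ≤ phaseLevel (K := K) a (l + 1)} ×ˢ
          Set.univ := by
        rintro x ⟨hx1, hx2⟩
        simp only [readySet_eq, Set.mem_ofPred_eq, not_or, not_le] at hx1 hx2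
        exact ⟨⟨hx2.2, hx1.resolve_left hx2.1⟩, trivial⟩
      have hle : u ≤ phaseLevel (K := K) a (l + 1) := level_le_succ (by positivity) hz0 l
      have hBle : ((volume : Measure unitInterval).prod (envLaw P)).real B ≤
          phaseLevel (K := K) a (l + 1) - u := by
        refine (measureReal_mono hBsub).trans ?_
        rw [measureReal_prod_prod, probReal_univ, mul_one]
        have hsplit : {v : unitInterval | u < v ∧ (v : ℝ) ≤ phaseLevel (K := K) a (l + 1)} =
            {v : unitInterval | (v : ℝ) ≤ phaseLevel (K := K) a (l + 1)} \
              {v : unitInterval | (v : ℝ) ≤ u} := by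
          ext v; simp [and_comm]
        have hsub : {v : unitInterval | (v : ℝ) ≤ u} ⊆
            {v : unitInterval | (v : ℝ) ≤ phaseLevel (K := K) a (l + 1)} :=
          fun v (hv : (v : ℝ) ≤ u) => hv.trans hle
        rw [hsplit, measureReal_sdiff hsub (measurableSet_unitInterval_le u),
          volume_real_unitInterval_le hu01, volume_real_unitInterval_le (phaseLevel_mem _)]
      have hae : ∀ᵐ x ∂((volume : Measure unitInterval).prod (envLaw P)),
          -1 ≤ x.2.1 j - x.2.1 k := by
        filter_upwards [Measure.quasiMeasurePreserving_snd.ae (ae_envLaw_fst h.mem_Icc)] with x hx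
        linarith [(hx j).1, (hx k).2]
      calc -(phaseLevel (K := K) a (l + 1) - u)
          ≤ -((volume : Measure unitInterval).prod (envLaw P)).real B := by linarith
        _ = ∫ x in B, (-1 : ℝ) ∂((volume : Measure unitInterval).prod (envLaw P)) := by simp
        _ ≤ _ := integral_mono_ae (integrable_const _) hFi.integrableOn (ae_restrict_of_ae hae)
    have hsucc : phaseLevel (K := K) a (l + 1) - u ≤ 1 / (4 * a) * (u + z) :=
      level_succ_sub_le _ _ l
    have hC : readySet P a r l ∩ Prod.snd ⁻¹' A = {x : unitInterval × Env K |
        (x.2 ∈ Z ∨ (x.1 : ℝ) ≤ u) ∧ x.2 ∈ A} := rfl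
    rw [exploreSet_succ, setIntegral_union (by
        rw [Set.disjoint_left]; exact fun x hx hx' => hx'.2 hx.1) hBm hFi.integrableOn
      hFi.integrableOn, hC, hmain]
    have h3 : u * (1 / (2 * a)) ≤ u * ∫ e in A, (e.1 j - e.1 k) ∂envLaw P :=
      mul_le_mul_of_nonneg_left hhigh hu01.1
    have h4 : (1 - u) * (1 / (2 * a) * z) ≤ (1 - u) * ∫ e in Z ∩ A, (e.1 j - e.1 k) ∂envLaw P :=
      mul_le_mul_of_nonneg_left hboth (by linarith [hu01.2])
    -- The gain is `(u + (1 - u) z) / (2a)`, and `u + (1 - u) z ≥ (u + z) / 2` on the unit square.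
    -- This is why the growth rate is `1 / (4a)`, half of the gain.
    have h5 : (1 : ℝ) / (4 * a) * (u + z) ≤ u * (1 / (2 * a)) + (1 - u) * (1 / (2 * a) * z) := by
      have : u * (1 / (2 * a)) + (1 - u) * (1 / (2 * a) * z) - (1 : ℝ) / (4 * a) * (u + z) =
          1 / (4 * a) * (u * (1 - z) + z * (1 - u)) := by field_simp; ring
      have h6 : 0 ≤ 1 / (4 * (a : ℝ)) * (u * (1 - z) + z * (1 - u)) := by
        have := hu01.1; have := hu01.2
        refine mul_nonneg (by positivity) (add_nonneg (mul_nonneg ?_ ?_) (mul_nonneg ?_ ?_)) <;>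
          linarith
      linarith
    linarith

end Explore

/-! ### Histories -/

/-- The samples of each arm that are recorded in a history. -/
def historyData {K : ℕ} (h : List (Fin K × Bool)) (i : Fin K) (k : ℕ) : Bool :=
  ((h.filter fun p => p.1 = i).map Prod.snd).reverse.getD k false

namespace BanditAlgorithm

variable {K : ℕ} (alg : BanditAlgorithm K)

lemma history_succ (x : alg.Seed × Env K) (t : ℕ) : alg.history x (t + 1) =
    (alg.arm t x, sample x.2 (alg.arm t x) (alg.numSamples t (alg.arm t x) x)) ::
      alg.history x t := rfl

lemma length_history (x : alg.Seed × Env K) (t : ℕ) : (alg.history x t).length = t := by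
  induction t with
  | zero => rfl
  | succ t ih => rw [history_succ, List.length_cons, ih]

lemma numSamples_succ (x : alg.Seed × Env K) (t : ℕ) (i : Fin K) : alg.numSamples (t + 1) i x =
    alg.numSamples t i x + if alg.arm t x = i then 1 else 0 := by
  rw [numSamples, history_succ, List.countP_cons]
  simp [numSamples]

lemma numSamples_mono (x : alg.Seed × Env K) (i : Fin K) {s t : ℕ} (h : s ≤ t) :
    alg.numSamples s i x ≤ alg.numSamples t i x :=
  monotone_nat_of_le_succ (f := fun t => alg.numSamples t i x)
    (fun t => by rw [numSamples_succ]; exact Nat.le_add_right _ _) h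

lemma le_numSamples_of_arm_eq (x : alg.Seed × Env K) (i : Fin K) (s m : ℕ)
    (h : ∀ t, s ≤ t → t < s + m → alg.arm t x = i) : m ≤ alg.numSamples (s + m) i x := by
  induction m with
  | zero => exact Nat.zero_le _
  | succ m ih =>
    rw [← add_assoc, numSamples_succ, if_pos (h (s + m) (by omega) (by omega))]
    have := ih fun t h1 h2 => h t h1 (by omega)
    omega

lemma reverse_filter_history (x : alg.Seed × Env K) (t : ℕ) (i : Fin K) :
    (((alg.history x t).filter fun p => p.1 = i).map Prod.snd).reverse =
      (List.range (alg.numSamples t i x)).map (sample x.2 i) := by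
  induction t with
  | zero => rfl
  | succ t ih =>
    rw [history_succ, numSamples_succ]
    by_cases h : alg.arm t x = i
    · rw [List.filter_cons_of_pos (by simpa using h), if_pos h, List.range_succ, List.map_append,
        ← ih]
      simp [h]
    · rw [List.filter_cons_of_neg (by simpa using h), if_neg h, ih, add_zero]

lemma historyData_history (x : alg.Seed × Env K) (t : ℕ) (i : Fin K) {k : ℕ}
    (hk : k < alg.numSamples t i x) : historyData (alg.history x t) i k = sample x.2 i k := by
  rw [historyData, reverse_filter_history, List.getD_eq_getElem _ _ (by simpa using hk)]
  simp

end BanditAlgorithm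

/-! ### The algorithm -/

section Explorer

variable {K : ℕ} (P : Fin K → Measure ℝ) (a N : ℕ)

lemma successes_congr {n : ℕ} {d d' : ℕ → Bool} (h : ∀ k < n, d k = d' k) :
    successes n d = successes n d' :=
  Finset.sum_congr rfl fun k hk => by rw [h k (Finset.mem_range.1 hk)]

variable {P a} in
lemma ready_congr {r : Fin K} {l : ℕ} {u : unitInterval} {d d' : Fin K → ℕ → Bool}
    (h : ∀ i ∈ earlier P r, ∀ k < a ^ 2, d i k = d' i k) :
    Ready P a r l u d ↔ Ready P a r l u d' := by
  unfold Ready LooksLow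
  refine or_congr_left (forall₂_congr fun i hi => ?_)
  rw [successes_congr (h i hi)]

variable {P a} in
-- The decision reads the samples of the arm itself only if it was ready in an earlier phase, that
-- is, only when these have been collected. This lets the algorithm decide from its history.
lemma explore_congr {r : Fin K} {l : ℕ} {u : unitInterval} {d d' : Fin K → ℕ → Bool}
    (h : ∀ i ∈ earlier P r, ∀ k < a ^ 2, d i k = d' i k)
    (h' : ∀ l' < l, Ready P a r l' u d' → ∀ k < a ^ 2, d (armOrder P r) k = d' (armOrder P r) k) :
    Explore P a r l u d ↔ Explore P a r l u d' := by
  cases l with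
  | zero => exact ready_congr h
  | succ l =>
    change (Ready P a r l u d ∧ LooksHigh (a ^ 2) (topMean P) (d (armOrder P r)) ∨
      Ready P a r (l + 1) u d ∧ ¬ Ready P a r l u d) ↔
      (Ready P a r l u d' ∧ LooksHigh (a ^ 2) (topMean P) (d' (armOrder P r)) ∨
      Ready P a r (l + 1) u d' ∧ ¬ Ready P a r l u d')
    rw [ready_congr h, ready_congr h]
    refine or_congr_left (and_congr_right fun hr => ?_)
    unfold LooksHigh
    rw [successes_congr (h' l (Nat.lt_succ_self l) hr)]

variable {P a} in
-- In the first phase in which the arm is ready, it is recommended as newly ready.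
lemma exists_explore_of_ready {r : Fin K} {l : ℕ} {u : unitInterval} {d : Fin K → ℕ → Bool}
    (h : Ready P a r l u d) : ∃ l' ≤ l, Explore P a r l' u d := by
  induction l with
  | zero => exact ⟨0, le_rfl, h⟩
  | succ l ih =>
    by_cases hr : Ready P a r l u d
    · obtain ⟨l', hl', he⟩ := ih hr
      exact ⟨l', hl'.trans (Nat.le_succ l), he⟩
    · exact ⟨l + 1, le_rfl, Or.inr ⟨h, hr⟩⟩

lemma measurableSet_explore (r : Fin K) (l : ℕ) (d : Fin K → ℕ → Bool) :
    MeasurableSet {u | Explore P a r l u d} := by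
  have hr : ∀ l, MeasurableSet {u | Ready P a r l u d} := fun l =>
    (MeasurableSet.const _).union (measurableSet_unitInterval_le _)
  cases l with
  | zero => exact hr 0
  | succ l => exact ((hr l).inter (MeasurableSet.const _)).union ((hr (l + 1)).inter (hr l).compl)

open Classical in
/-- The recommendation in phase `l` of the arm of rank `r`. -/
def choice (fallback : Fin K → ℕ → Fin K) (r : Fin K) (l : ℕ) (u : unitInterval)
    (d : Fin K → ℕ → Bool) : Fin K :=
  if Explore P a r l u d then armOrder P r else fallback r l

/-- The length of a phase. -/
def phaseLength : ℕ := max N (a ^ 2)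

variable [NeZero K]

/-- The rank of the arm which is explored around round `t`. -/
def rankAt (t : ℕ) : Fin K := Fin.ofNat K (t / phaseLength a N / (phases K a + 1))

/-- The phase to which the round `t` belongs. -/
def phaseAt (t : ℕ) : ℕ := t / phaseLength a N % (phases K a + 1)

/-- The algorithm which explores the arms in the order of decreasing prior means. The seed is
uniform on `[0, 1]`. Each arm has the same number of phases, in each of which the same arm is
recommended all the time. -/
abbrev explorer (fallback : Fin K → ℕ → Fin K) : BanditAlgorithm K where
  Seed := unitInterval
  measurableSpace := inferInstance
  seedLaw := volume
  isProbabilityMeasure := inferInstance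
  recommend u h :=
    choice P a fallback (rankAt a N h.length) (phaseAt (K := K) a N h.length) u (historyData h)
  measurable_recommend _ :=
    Measurable.ite (measurableSet_explore P a _ _ _) measurable_const measurable_const

variable {P a N} {fallback : Fin K → ℕ → Fin K}

lemma explorer_arm (t : ℕ) (x : unitInterval × Env K) : (explorer P a N fallback).arm t x =
    choice P a fallback (rankAt a N t) (phaseAt (K := K) a N t) x.1
      (historyData ((explorer P a N fallback).history x t)) := by
  change choice P a fallback (rankAt a N ((explorer P a N fallback).history x t).length)
    (phaseAt (K := K) a N ((explorer P a N fallback).history x t).length) x.1 _ = _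
  rw [BanditAlgorithm.length_history]

lemma phaseLength_pos (ha : 0 < a) : 0 < phaseLength a N :=
  lt_of_lt_of_le (by positivity) (le_max_right _ _)

/-- The total number of rounds. -/
def totalRounds (K a N : ℕ) : ℕ := K * (phases K a + 1) * phaseLength a N

/-- The rounds which belong to phase `l` of the arm of rank `r`. -/
lemma rankAt_phaseAt {r : Fin K} {l t : ℕ} (hl : l ≤ phases K a)
    (h1 : (r * (phases K a + 1) + l) * phaseLength a N ≤ t)
    (h2 : t < (r * (phases K a + 1) + l + 1) * phaseLength a N) :
    rankAt a N t = r ∧ phaseAt (K := K) a N t = l := by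
  have hd : t / phaseLength a N = r * (phases K a + 1) + l := Nat.div_eq_of_lt_le h1 h2
  have hl' : l < phases K a + 1 := Nat.lt_succ_of_le hl
  constructor
  · rw [rankAt, hd, mul_comm, Nat.mul_add_div (Nat.succ_pos _), Nat.div_eq_of_lt hl', add_zero]
    ext; simp [Fin.ofNat, Nat.mod_eq_of_lt r.2]
  · rw [phaseAt, hd, mul_comm, Nat.mul_add_mod, Nat.mod_eq_of_lt hl']

/-- If the algorithm has worked as intended before round `t`, then each arm which is ready in a
phase which has ended has been sampled sufficiently often. -/
lemma phaseLength_le_numSamples {t : ℕ} {x : unitInterval × Env K}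
    (h : ∀ t' < t, (explorer P a N fallback).arm t' x =
      choice P a fallback (rankAt a N t') (phaseAt (K := K) a N t') x.1 (sample x.2))
    {r : Fin K} {l : ℕ} (hl : l ≤ phases K a) (hr : Ready P a r l x.1 (sample x.2))
    (ht : (r * (phases K a + 1) + l + 1) * phaseLength a N ≤ t) :
    phaseLength a N ≤ (explorer P a N fallback).numSamples t (armOrder P r) x := by
  obtain ⟨l', hl', he⟩ := exists_explore_of_ready hr
  have hend : (r * (phases K a + 1) + l') * phaseLength a N + phaseLength a N ≤ t := by
    refine le_trans ?_ ht
    rw [← Nat.succ_mul]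
    exact Nat.mul_le_mul_right _ (by omega)
  refine le_trans (BanditAlgorithm.le_numSamples_of_arm_eq (explorer P a N fallback) x _
    ((r * (phases K a + 1) + l') * phaseLength a N) _ fun s hs1 hs2 => ?_)
    (BanditAlgorithm.numSamples_mono (explorer P a N fallback) x _ hend)
  obtain ⟨h1, h2⟩ := rankAt_phaseAt (hl'.trans hl) hs1 (by rw [Nat.succ_mul]; exact hs2)
  rw [h s (by omega), h1, h2, choice, if_pos he]

/-- The algorithm works as intended. -/
lemma explorer_arm_eq (ha : 0 < a) {t : ℕ} (ht : t < totalRounds K a N)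
    (x : unitInterval × Env K) : (explorer P a N fallback).arm t x =
      choice P a fallback (rankAt a N t) (phaseAt (K := K) a N t) x.1 (sample x.2) := by
  induction t using Nat.strong_induction_on with
  | _ t ih =>
    have hpos := phaseLength_pos (N := N) ha
    have ih' := fun t' ht' => ih t' ht' (ht'.trans ht)
    set b := t / phaseLength a N with hb
    have hbt : b * phaseLength a N ≤ t := Nat.div_mul_le_self _ _
    have hrank : b / (phases K a + 1) < K := by
      rw [Nat.div_lt_iff_lt_mul (Nat.succ_pos _), Nat.div_lt_iff_lt_mul hpos]
      exact ht
    have hr : (rankAt a N t : Fin K).val = b / (phases K a + 1) := by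
      simp [rankAt, Fin.ofNat, ← hb, Nat.mod_eq_of_lt hrank]
    have hbsplit : (rankAt a N t : Fin K).val * (phases K a + 1) + phaseAt (K := K) a N t = b := by
      rw [hr, phaseAt, ← hb]; exact Nat.div_add_mod' _ _
    have hl : phaseAt (K := K) a N t ≤ phases K a :=
      Nat.le_of_lt_succ (Nat.mod_lt _ (Nat.succ_pos _))
    -- Whenever a sample matters for the decision, the history contains it, so the default value
    -- `false` in `historyData` is harmless.
    have hsampled : ∀ (r : Fin K) (l : ℕ), l ≤ phases K a → Ready P a r l x.1 (sample x.2) →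
        r * (phases K a + 1) + l < b → ∀ k < a ^ 2,
        historyData ((explorer P a N fallback).history x t) (armOrder P r) k =
          sample x.2 (armOrder P r) k := by
      intro r l hl hready hlt k hk
      refine BanditAlgorithm.historyData_history (explorer P a N fallback) x t _ (hk.trans_le ?_)
      exact (le_max_right N (a ^ 2)).trans (phaseLength_le_numSamples ih' hl hready
        (le_trans (Nat.mul_le_mul_right _ hlt) hbt))
    have hcongr : Explore P a (rankAt a N t) (phaseAt (K := K) a N t) x.1
        (historyData ((explorer P a N fallback).history x t)) ↔
        Explore P a (rankAt a N t) (phaseAt (K := K) a N t) x.1 (sample x.2) := by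
      refine explore_congr (fun i hi => ?_) fun l hl' hready => ?_
      -- Arms of smaller rank have completed all their phases, the last of which has level `1` and
      -- so is ready for every seed.
      · have := hsampled ((armOrder P).symm i) (phases K a) le_rfl
          (Or.inr (by rw [phaseLevel_phases ha]; exact x.1.2.2)) (by
            have h1 : ((armOrder P).symm i).val < (rankAt a N t : Fin K).val := hi
            have h2 : (((armOrder P).symm i).val + 1) * (phases K a + 1) ≤
              (rankAt a N t : Fin K).val * (phases K a + 1) := Nat.mul_le_mul_right _ h1
            rw [Nat.succ_mul] at h2
            omega)
        rwa [Equiv.apply_symm_apply] at this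
      · exact hsampled _ l (by omega) hready (by omega)
    rw [explorer_arm]
    classical exact if_congr hcongr rfl rfl

/-- The level of the last phase is `1`, so every arm fills at least one whole phase, for every seed
and environment. -/
lemma explorer_collects (ha : 0 < a) :
    (explorer P a N fallback).Collects P (totalRounds K a N) N := by
  refine Filter.Eventually.of_forall fun x i => ?_
  have h := phaseLength_le_numSamples (P := P) (N := N) (fallback := fallback)
    (fun t' ht' => explorer_arm_eq ha ht' x) (r := (armOrder P).symm i) (le_refl (phases K a))
    (Or.inr (by rw [phaseLevel_phases ha]; exact x.1.2.2)) (by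
      refine Nat.mul_le_mul_right _ ?_
      have h2 : (((armOrder P).symm i).val + 1) * (phases K a + 1) ≤ K * (phases K a + 1) :=
        Nat.mul_le_mul_right _ ((armOrder P).symm i).2
      rw [Nat.succ_mul] at h2
      omega)
  rw [Equiv.apply_symm_apply] at h
  exact (le_max_left _ _).trans h

/-! ### Incentive compatibility -/

/-- In a given round only two arms can occur: the one under exploration on `E`, and the fallback on
the complement. The event of recommending `i` is thus one of these two sets, everything, or empty.
Conditioning only multiplies the integral by a nonnegative constant. -/
lemma explorer_isBIC (h : HasGap P (1 / a)) (ha : 0 < a)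
    (hfb : ∀ r l k, 0 ≤ ∫ x in (exploreSet P a r l)ᶜ, (x.2.1 (fallback r l) - x.2.1 k)
      ∂((volume : Measure unitInterval).prod (envLaw P))) :
    (explorer P a N fallback).IsBIC P (totalRounds K a N) := by
  intro t ht i k _
  have hprob := h.isProbabilityMeasure
  set r : Fin K := rankAt a N t
  set l := phaseAt (K := K) a N t
  set E := exploreSet P a r l with hE
  have hS : {x : unitInterval × Env K | (explorer P a N fallback).arm t x = i} =
      {x | (x ∈ E ∧ armOrder P r = i) ∨ (x ∉ E ∧ fallback r l = i)} := by
    ext x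
    simp only [Set.mem_ofPred_eq]
    rw [explorer_arm_eq ha ht x, choice]
    by_cases hx : Explore P a r l x.1 (sample x.2)
    · have hx' : x ∈ E := hx
      rw [if_pos hx]; simp [hx', r]
    · have hx' : x ∉ E := hx
      rw [if_neg hx]; simp [hx', r, l]
  have hEm : MeasurableSet E := measurableSet_exploreSet P a r l
  have hFi := integrable_reward_sub h.isProbabilityMeasure h.mem_Icc i k
  have hkey : 0 ≤ ∫ x in {x : unitInterval × Env K | (explorer P a N fallback).arm t x = i},
      (x.2.1 i - x.2.1 k) ∂((volume : Measure unitInterval).prod (envLaw P)) := by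
    rw [hS]
    have hexp := h.integral_exploreSet_nonneg ha r l k
    have hf := hfb r l k
    by_cases h1 : armOrder P r = i <;> by_cases h2 : fallback r l = i <;>
      simp only [h1, h2, and_true, and_false, or_false, false_or]
    · rw [h1] at hexp
      rw [h2] at hf
      have : {x : unitInterval × Env K | x ∈ E ∨ x ∉ E} = E ∪ Eᶜ := rfl
      rw [this, setIntegral_union disjoint_compl_right hEm.compl hFi.integrableOn
        hFi.integrableOn]
      exact add_nonneg hexp hf
    · rw [h1] at hexp; exact hexp
    · rw [h2] at hf; exact hf
    · simp
  change 0 ≤ ∫ x : unitInterval × Env K, (x.2.1 i - x.2.1 k)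
    ∂(((volume : Measure unitInterval).prod (envLaw P))[|{x : unitInterval × Env K |
      (explorer P a N fallback).arm t x = i}])
  rw [ProbabilityTheory.cond, integral_smul_measure]
  exact smul_nonneg ENNReal.toReal_nonneg hkey

end Explorer

/-- Some arm is optimal on average on any given event. -/
lemma exists_forall_setIntegral_nonneg {K : ℕ} [NeZero K] {P : Fin K → Measure ℝ}
    (hP : ∀ i, IsProbabilityMeasure (P i)) (hP' : ∀ i, ∀ᵐ x ∂P i, x ∈ Set.Icc (0 : ℝ) 1)
    (S : Set (unitInterval × Env K)) :
    ∃ f : Fin K, ∀ k, 0 ≤ ∫ x in S, (x.2.1 f - x.2.1 k)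
      ∂((volume : Measure unitInterval).prod (envLaw P)) := by
  obtain ⟨f, hf⟩ := Finite.exists_max fun i : Fin K => ∫ x in S, (x.2.1 i - x.2.1 0)
      ∂((volume : Measure unitInterval).prod (envLaw P))
  refine ⟨f, fun k => ?_⟩
  have h1 := integral_sub (integrable_reward_sub hP hP' f 0).integrableOn
    (integrable_reward_sub hP hP' k 0).integrableOn (μ :=
      ((volume : Measure unitInterval).prod (envLaw P)).restrict S)
  simp only [sub_sub_sub_cancel_right] at h1
  rw [h1]
  exact sub_nonneg.2 (hf k)

theorem HasGap.optimalRounds_le {K a : ℕ} (hK : 0 < K) {P : Fin K → Measure ℝ}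
    (h : HasGap P (1 / a)) (ha : 0 < a) (N : ℕ) : optimalRounds P N ≤ (totalRounds K a N : ℕ∞) := by
  have : NeZero K := ⟨hK.ne'⟩
  choose fallback hfb using fun (r : Fin K) (l : ℕ) =>
    exists_forall_setIntegral_nonneg h.isProbabilityMeasure h.mem_Icc (exploreSet P a r l)ᶜ
  exact iInf₂_le (totalRounds K a N)
    ⟨explorer P a N fallback, explorer_isBIC h ha hfb, explorer_collects ha⟩

/-- The constant is `8 + 4 + 1`, from `4a (2aK + 1) + 1`, with each term bounded by a multiple of
`a² K`. -/
lemma totalRounds_le {K a N : ℕ} (hK : 0 < K) (ha : 0 < a) :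
    totalRounds K a N ≤ 13 * a ^ 2 * K ^ 2 * (N + a ^ 2) := by
  have h1 : phaseLength a N ≤ N + a ^ 2 := max_le (Nat.le_add_right _ _) (Nat.le_add_left _ _)
  have h2 : phases K a + 1 ≤ 13 * a ^ 2 * K := by
    have h3 : a ≤ a ^ 2 * K := by nlinarith [Nat.mul_le_mul ha hK, Nat.mul_le_mul_left (a ^ 2) hK]
    have h4 : 1 ≤ a ^ 2 * K := Nat.mul_pos (by positivity) hK
    rw [phases]; nlinarith
  calc totalRounds K a N = K * (phases K a + 1) * phaseLength a N := rfl
    _ ≤ K * (13 * a ^ 2 * K) * (N + a ^ 2) := by gcongr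
    _ = _ := by ring

end IncentivizedExploration

end

theorem corollary5p5 :
    -- part (a)
    (∀ C_TS : ℝ, 0 < C_TS → ∃ C : ℝ, 0 < C ∧ ∃ a : ℕ,
      ∀ (K : ℕ) (ν : Fin K → ℝ) (σ : ℝ), 0 < K → (∀ i, ν i ∈ Set.Icc (0 : ℝ) 1) → 0 < σ → σ ^ 2 ≤ 1 →
        ∃ T : ℕ,
          IncentivizedExploration.optimalRounds
              (fun i => IncentivizedExploration.truncatedGaussian (ν i) σ)
              (IncentivizedExploration.samplesTS C_TS
                (fun i => IncentivizedExploration.truncatedGaussian (ν i) σ)) = (T : ℕ∞) ∧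
          (T : ℝ) ≤ (K : ℝ) ^ 3 *
            (C * (σ⁻¹ * Real.exp ((σ⁻¹ * IncentivizedExploration.spread ν) ^ 2)) ^ a)) ∧
    -- part (b)
    (∀ c₀ : ℝ, 0 < c₀ → ∃ c : ℝ, 0 < c ∧
      ∀ (K : ℕ) (ν : Fin K → ℝ) (σ : ℝ), (∀ i, ν i ∈ Set.Icc (0 : ℝ) 1) → 0 < σ → σ ^ 2 ≤ 1 →
        c₀ ≤ IncentivizedExploration.spread ν →
          ENNReal.ofReal (Real.exp (c / σ ^ 2)) ≤
            IncentivizedExploration.lowerBoundRounds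
              (fun i => IncentivizedExploration.truncatedGaussian (ν i) σ)) := by
  -- The number of rounds is at most `13 (C_TS + 2) K³ a⁷` with `a ≤ 65537 y⁴`, whence the exponent
  -- `28 = 4 * 7`.
  refine ⟨fun C_TS hC => ⟨13 * (C_TS + 2) * 65537 ^ 7, by positivity, 28,
    fun K ν σ hK hν hσ hσ1 => ?_⟩, IncentivizedExploration.exists_exp_le_lowerBoundRounds⟩
  open IncentivizedExploration in
  have hσ1 : σ ≤ 1 := by nlinarith
  set P := fun i => truncatedGaussian (ν i) σ with hP
  set y := σ⁻¹ * Real.exp ((σ⁻¹ * spread ν) ^ 2) with hy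
  have hy1 : 1 ≤ y := by
    have h1 := (one_le_inv₀ hσ).2 hσ1
    have h2 : 1 ≤ Real.exp ((σ⁻¹ * spread ν) ^ 2) := Real.one_le_exp (by positivity)
    exact one_le_mul_of_one_le_of_one_le h1 h2
  have hgap := hasGap_truncatedGaussian hν hσ hσ1
  have hinv : (gaussGap σ (spread ν))⁻¹ ≤ 65536 * y ^ 4 := by
    have h1 : 1 ≤ Real.exp ((σ⁻¹ * spread ν) ^ 2) := Real.one_le_exp (by positivity)
    -- Here `65536 = (4 * 64)²`. The ceiling in `a` adds at most `1 ≤ y⁴`, which turns it into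
    -- `65537`.
    have h2 : (gaussGap σ (spread ν))⁻¹ =
        65536 * ((σ⁻¹) ^ 4 * Real.exp ((σ⁻¹ * spread ν) ^ 2) ^ 1) := by
      rw [gaussGap, Real.exp_neg]; field_simp; norm_num
    rw [h2, hy, mul_pow σ⁻¹ (Real.exp _)]
    gcongr
    norm_num
  set a := ⌈(gaussGap σ (spread ν))⁻¹⌉₊ with ha_def
  have ha : 0 < a := Nat.ceil_pos.2 (inv_pos.2 hgap.pos)
  have ha' : (0 : ℝ) < a := by exact_mod_cast ha
  have hgap' : HasGap P (1 / a) := hgap.mono (by positivity)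
    ((one_div_le ha' hgap.pos).2 (by rw [one_div]; exact Nat.le_ceil _))
  have hay : (a : ℝ) ≤ 65537 * y ^ 4 := by
    have h1 := (Nat.ceil_lt_add_one (inv_pos.2 hgap.pos).le).le
    have h2 : 1 ≤ y ^ 4 := one_le_pow₀ hy1
    linarith
  have hN := hgap'.samplesTS_le hK hC
  rw [one_div, inv_inv] at hN
  have hle := hgap'.optimalRounds_le hK ha (samplesTS C_TS P)
  obtain ⟨T, hT⟩ := ENat.ne_top_iff_exists.1 (ne_top_of_le_ne_top (ENat.natCast_ne_top _) hle)
  refine ⟨T, hT.symm, ?_⟩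
  rw [← hT, Nat.cast_le] at hle
  have hT' : (T : ℝ) ≤ 13 * a ^ 2 * K ^ 2 * (samplesTS C_TS P + a ^ 2) := by
    exact_mod_cast hle.trans (totalRounds_le hK ha)
  have hK1 : (1 : ℝ) ≤ K := by exact_mod_cast hK
  have ha1 : (1 : ℝ) ≤ a := by exact_mod_cast ha
  have h5 : (samplesTS C_TS P : ℝ) + a ^ 2 ≤ (C_TS + 2) * a ^ 5 * K := by
    have h6 : (a : ℝ) ^ 3 ≤ a ^ 5 := pow_le_pow_right₀ ha1 (by norm_num)
    have h7 : (a : ℝ) ^ 2 ≤ a ^ 5 := pow_le_pow_right₀ ha1 (by norm_num)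
    have h8 : (1 : ℝ) ≤ a ^ 5 := one_le_pow₀ ha1
    have h9 : (a : ℝ) ^ 5 ≤ a ^ 5 * K := le_mul_of_one_le_right (by positivity) hK1
    have h10 : C_TS * a ^ 3 * K ≤ C_TS * a ^ 5 * K := by gcongr
    nlinarith
  calc (T : ℝ) ≤ 13 * a ^ 2 * K ^ 2 * ((C_TS + 2) * a ^ 5 * K) := hT'.trans (by gcongr)
    _ = K ^ 3 * (13 * (C_TS + 2) * a ^ 7) := by ring
    _ ≤ K ^ 3 * (13 * (C_TS + 2) * (65537 * y ^ 4) ^ 7) := by gcongr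
    _ = _ := by ring
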